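/- Let $k\ge 1$ be an integer. Let $F=\bigoplus_{m,n\in\mathbb Z}F_{m,n}$ be the (algebraic) direct sum of the Fock spaces of the free boson compactified at radius $R=1/\sqrt{2k}$: $F_{m,n}$ is generated freely from a state $|m,n\rangle$ by the creation modes $a_{-j},\bar a_{-j}$ ($j\ge 1$), where the modes $a_j,\bar a_j$ ($j\in\mathbb Z$) satisfy $[a_i,a_j]=[\bar a_i,\bar a_j]=i\,\delta_{i+j,0}$, $[a_i,\bar a_j]=0$, the modes $a_j,\bar a_j$ with $j>0$ annihilate $|m,n\rangle$, and $a_0,\bar a_0$ act on $F_{m,n}$ as the scalars $(mk\pm n)/\sqrt{2k}$. Put $L_0=\tfrac12a_0^2+\sum_{j\ge1}a_{-j}a_j$ and $\bar L_0=\tfrac12\bar a_0^2+\sum_{j\ge1}\bar a_{-j}\bar a_j$. Define the modes $J^\pm_r$ ($r\in\mathbb Z$) by $$\sum_{r\in\mathbb Z}J^\pm_r z^{-r-k}=e^{\pm\sqrt{2k}\sum_{j>0}a_{-j}z^j/j}\;T^{\pm1}\,z^{\pm\sqrt{2k}\,a_0}\;e^{\mp\sqrt{2k}\sum_{j>0}a_{j}z^{-j}/j},$$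 where $T$ commutes with all $a_j,\bar a_j$, $j\neq0$, and $T|m,n\rangle=|m+1,n+k\rangle$; define $\bar J^\pm_r$ in the same way with $\bar a_j$ in place of $a_j$ and $\bar T|m,n\rangle=|m+1,n-k\rangle$ in place of $T$. Let $$S=\{a_ia_j,\ J^+_r+J^-_r,\ a_i(J^+_r-J^-_r),\ \bar a_i\bar a_j,\ \bar J^+_r+\bar J^-_r,\ \bar a_i(\bar J^+_r-\bar J^-_r)\;:\; i,j,r\in\mathbb Z\}.$$ For $v\in F$ and $\epsilon,\epsilon'\in\{e,o\}$ let $F^{\epsilon\epsilon'}(v)$ be the span of all states $a_{-n_1}\cdots a_{-n_i}\bar a_{-m_1}\cdots\bar a_{-m_j}v$ (all $n_\nu,m_\nu\ge 1$) in which $i$ is even if $\epsilon=e$ and odd if $\epsilon=o$, and $j$ is even if $\epsilon'=e$ and odd if $\epsilon'=o$. For $s,s'>0$, with $u_\pm=|s+s',k(s-s')\rangle\pm|{-(s+s')},-k(s-s')\rangle$ and $w_\pm=|s-s',k(s+s')\rangle\pm|{-(s-s')},-k(s+s')\rangle$, put $$H^{Ub}_{s+s',k(s-s')}=F^{oo}(u_++w_+)\oplus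 F^{ee}(u_+-w_+)\oplus F^{eo}(u_-+w_-)\oplus F^{oe}(u_--w_-),$$ $$H^{Ub}_{s,ks}=F^{oo}(|s,ks\rangle+|{-s},-ks\rangle)\oplus F^{eo}(|s,ks\rangle-|{-s},-ks\rangle),$$ $$H^{Ub}_{s',-ks'}=F^{oo}(|s',-ks'\rangle+|{-s'},ks'\rangle)\oplus F^{oe}(|s',-ks'\rangle-|{-s'},ks'\rangle),\qquad H^{Ub}_{0,0}=F^{oo}(|0,0\rangle),$$ and let $$H_1=\sum_{s,s'>0}H^{Ub}_{s+s',k(s-s')}\oplus\sum_{s>0}H^{Ub}_{s,ks}\oplus\sum_{s'>0}H^{Ub}_{s',-ks'}\oplus H^{Ub}_{0,0}.$$ Then: (a) Starting from the state $a_{-1}\bar a_{-1}|0,0\rangle$, $S$ generates precisely the module $H_1$: the set of all $X a_{-1}\bar a_{-1}|0,0\rangle$, with $X$ in the algebra of operators generated by $S$, is equal to $H_1$. (b) For $0<q<1$, $L_0+\bar L_0$ is diagonalizable on $H_1$ with real eigenvalues of finite multiplicity, the trace of $q^{L_0+\bar L_0-1/12}$ over $H_1$ converges, and $$\mathrm{Tr}_{H_1}\,q^{L_0+\bar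 L_0-1/12}=\chi^*_-(q)^2,\qquad \chi^*_-(q)=\frac12\bigl(\chi_0(q)-\chi_c(q)\bigr),$$ where $\chi_0(q)=\sum_{n\in\mathbb Z}q^{kn^2}/\eta(q)$, $\chi_c(q)=\sqrt{\theta_3(q)\theta_4(q)}/\eta(q)$, $\eta(q)=q^{1/24}\prod_{n\ge1}(1-q^n)$, $\theta_3(q)=\sum_{n\in\mathbb Z}q^{n^2/2}$ and $\theta_4(q)=\sum_{n\in\mathbb Z}(-1)^nq^{n^2/2}$. -/

import Mathlib

namespace OrbifoldBoson

noncomputable section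

/-! ### The Fock space of the compactified free boson at radius `R = 1 / √(2k)` -/

/-- The two chiralities: unbarred (holomorphic) and barred (antiholomorphic). -/
inductive Chirality
  | hol
  | anti

/-- `+1` for the unbarred and `-1` for the barred chirality. -/
def Chirality.sgn : Chirality → ℤ
  | .hol => 1
  | .anti => -1

/-- The Fock module over one highest weight state: the variable `X (c, n)` is the creation
operator `a_{-n}` (for `c = hol`) or `ā_{-n}` (for `c = anti`), `n ≥ 1`. -/
abbrev Fock : Type := MvPolynomial (Chirality × ℕ+) ℂ

/-- The untwisted space of states before orbifolding: the algebraic direct sum of the Fock modules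
over the states `|m, n⟩`, where `m` and `n` are the momentum and winding numbers. -/
abbrev StateSpace : Type := (ℤ × ℤ) →₀ Fock

/-- The state `|m, n⟩`. -/
def ket (m n : ℤ) : StateSpace := Finsupp.single (m, n) 1

/-- The eigenvalue of `a_0` (resp. `ā_0`) on the Fock module of `|m, n⟩`: it is
`m / (2R) ± n R = (m k ± n) / √(2k)`. -/
def charge (k : ℕ) (c : Chirality) (x : ℤ × ℤ) : ℝ :=
  ((x.1 : ℝ) * k + (c.sgn : ℝ) * x.2) / Real.sqrt (2 * k)

/-- The mode `a_j` (or `ā_j`) on a Fock module on which the zero mode acts as `p`: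
`a_j = j ∂/∂a_{-j}` for `j > 0`, `a_0 = p`, and `a_{j}` is multiplication by the corresponding
variable for `j < 0`; thus `[a_i, a_j] = i δ_{i+j,0}`. -/
def fockMode (c : Chirality) (p : ℂ) : ℤ → Module.End ℂ Fock
  | Int.ofNat 0 => p • 1
  | Int.ofNat (n + 1) =>
      ((n + 1 : ℕ) : ℂ) • (MvPolynomial.pderiv (c, n.succPNat) : Derivation ℂ Fock Fock).toLinearMap
  | Int.negSucc n => LinearMap.mulLeft ℂ (MvPolynomial.X (c, n.succPNat) : Fock)

/-- The oscillator mode `a_j` (`c = hol`) or `ā_j` (`c = anti`), `j ∈ ℤ`, on the space of states. -/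
def mode (k : ℕ) (c : Chirality) (j : ℤ) : Module.End ℂ StateSpace :=
  Finsupp.lsum ℂ fun x => Finsupp.lsingle x ∘ₗ fockMode c (charge k c x : ℂ) j

/-! ### The filtration by level, used only to show that the infinite sums below are finite
on each state -/

/-- The level `∑ n · (number of modes a_{-n}, ā_{-n})` of a monomial. -/
def level (d : (Chirality × ℕ+) →₀ ℕ) : ℤ := d.sum fun i e => (e : ℤ) * (i.2 : ℕ)

/-- The span of all monomial states of level at most `D`. -/
def levelLE (D : ℤ) : Submodule ℂ StateSpace :=
  Submodule.span ℂ {v | ∃ (x : ℤ × ℤ) (d : (Chirality × ℕ+) →₀ ℕ), level d ≤ D ∧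
    v = Finsupp.single x (MvPolynomial.monomial d 1)}

theorem level_nonneg (d : (Chirality × ℕ+) →₀ ℕ) : 0 ≤ level d :=
  Finset.sum_nonneg fun _ _ => by positivity

theorem levelLE_neg {D : ℤ} (hD : D < 0) : levelLE D = ⊥ := by
  rw [levelLE, Submodule.span_eq_bot]
  rintro v ⟨x, d, hd, -⟩
  have := level_nonneg d
  omega

theorem levelLE_mono {D E : ℤ} (h : D ≤ E) : levelLE D ≤ levelLE E := by
  apply Submodule.span_mono
  rintro v ⟨x, d, hd, rfl⟩
  exact ⟨x, d, hd.trans h, rfl⟩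

theorem exists_mem_levelLE (v : StateSpace) : ∃ D, v ∈ levelLE D := by
  induction v using Finsupp.induction_linear with
  | zero => exact ⟨0, zero_mem _⟩
  | add v w hv hw =>
    obtain ⟨D, hD⟩ := hv
    obtain ⟨E, hE⟩ := hw
    exact ⟨max D E, add_mem (levelLE_mono (le_max_left _ _) hD)
      (levelLE_mono (le_max_right _ _) hE)⟩
  | single x f =>
    induction f using MvPolynomial.induction_on' with
    | monomial d z =>
      refine ⟨level d, ?_⟩
      have h : (Finsupp.single x (MvPolynomial.monomial d z) : StateSpace)
          = z • Finsupp.single x (MvPolynomial.monomial d 1) := by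
        rw [Finsupp.smul_single, MvPolynomial.smul_monomial, smul_eq_mul, mul_one]
      rw [h]
      exact Submodule.smul_mem _ _ (Submodule.subset_span ⟨x, d, le_rfl, rfl⟩)
    | add f g hf hg =>
      obtain ⟨D, hD⟩ := hf
      obtain ⟨E, hE⟩ := hg
      refine ⟨max D E, ?_⟩
      rw [Finsupp.single_add]
      exact add_mem (levelLE_mono (le_max_left _ _) hD) (levelLE_mono (le_max_right _ _) hE)

theorem fockMode_pos (c : Chirality) (p : ℂ) (n : ℕ+) (f : Fock) :
    fockMode c p ((n : ℕ) : ℤ) f = ((n : ℕ) : ℂ) • MvPolynomial.pderiv (c, n) f := by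
  obtain ⟨m, rfl⟩ : ∃ m : ℕ, n = m.succPNat := ⟨n.natPred, (PNat.succPNat_natPred n).symm⟩
  rfl

theorem level_sub (d : (Chirality × ℕ+) →₀ ℕ) (i : Chirality × ℕ+) (hi : d i ≠ 0) :
    level (d - Finsupp.single i 1) = level d - (i.2 : ℕ) := by
  have h : d = (d - Finsupp.single i 1) + Finsupp.single i 1 := by
    classical
    ext j
    by_cases hj : j = i
    · subst hj
      simp
      omega
    · simp [Ne.symm hj]
  have key : level d = level (d - Finsupp.single i 1) + (i.2 : ℕ) := by
    conv_lhs => rw [h]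
    unfold level
    rw [Finsupp.sum_add_index' (by simp) (by intros; push_cast; ring)]
    simp
  omega

/-- An annihilation mode `a_n`, `n ≥ 1`, lowers the level by `n`. -/
theorem mode_pos_mem (k : ℕ) (c : Chirality) (n : ℕ+) {D : ℤ} {v : StateSpace}
    (hv : v ∈ levelLE D) : mode k c ((n : ℕ) : ℤ) v ∈ levelLE (D - (n : ℕ)) := by
  refine (Submodule.span_le (p := (levelLE (D - (n : ℕ))).comap (mode k c ((n : ℕ) : ℤ)))).2
    ?_ hv
  rintro _ ⟨x, d, hd, rfl⟩
  simp only [Submodule.comap_coe, Set.mem_preimage, SetLike.mem_coe, mode, Finsupp.lsum_single,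
    LinearMap.comp_apply, Finsupp.lsingle_apply, fockMode_pos, MvPolynomial.pderiv_monomial]
  by_cases hi : d (c, n) = 0
  · simp [hi]
  · have h : (Finsupp.single x (((n : ℕ) : ℂ) • MvPolynomial.monomial (d - Finsupp.single (c, n) 1)
        ((1 : ℂ) * (d (c, n) : ℂ))) : StateSpace) = (((n : ℕ) : ℂ) * (d (c, n) : ℂ)) •
        Finsupp.single x (MvPolynomial.monomial (d - Finsupp.single (c, n) 1) 1) := by
      rw [Finsupp.smul_single, MvPolynomial.smul_monomial, MvPolynomial.smul_monomial]
      simp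
    rw [h]
    refine Submodule.smul_mem _ _ (Submodule.subset_span ⟨x, _, ?_, rfl⟩)
    rw [level_sub d (c, n) hi]
    simpa using hd

/-! ### The Virasoro zero modes -/

theorem numberTerm_finite (k : ℕ) (c : Chirality) (v : StateSpace) :
    (Function.support fun n : ℕ+ =>
      mode k c (-((n : ℕ) : ℤ)) (mode k c ((n : ℕ) : ℤ) v)).Finite := by
  obtain ⟨D, hD⟩ := exists_mem_levelLE v
  refine ((Set.finite_Iic D.toNat).preimage (f := fun n : ℕ+ => (n : ℕ))
    PNat.coe_injective.injOn).subset ?_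
  intro n hn
  simp only [Set.mem_preimage, Set.mem_Iic]
  by_contra hlt
  apply hn
  have h := mode_pos_mem k c n hD
  rw [levelLE_neg (by omega), Submodule.mem_bot] at h
  simp [h]

/-- `L_0` (`c = hol`) or `L̄_0` (`c = anti`) of the untwisted sector:
`½ ∑_{n ∈ ℤ} :a_{-n} a_n: = ½ a_0² + ∑_{n ≥ 1} a_{-n} a_n`. -/
def virasoroZero (k : ℕ) (c : Chirality) : Module.End ℂ StateSpace where
  toFun v := (1 / 2 : ℂ) • mode k c 0 (mode k c 0 v)
    + ∑ᶠ n : ℕ+, mode k c (-((n : ℕ) : ℤ)) (mode k c ((n : ℕ) : ℤ) v)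
  map_add' v w := by
    simp only [map_add, smul_add]
    rw [finsum_add_distrib (numberTerm_finite k c v) (numberTerm_finite k c w)]
    abel
  map_smul' z v := by
    simp only [map_smul, RingHom.id_apply, smul_add]
    rw [smul_finsum z, smul_comm z]

/-! ### The currents `J^±` and `J̄^±` -/

/-- The coefficient of `z^N` in `exp (∑_{n ≥ 1} t_n z^n) = ∑_i (∑_{n ≥ 1} t_n z^n)^i / i!`, that is,
the Schur polynomial `S_N(t_1, …, t_N)`. Only the terms `i ≤ N` contribute to it. -/
def schur {A : Type*} [Ring A] [Algebra ℂ A] (t : ℕ+ → A) (N : ℕ) : A :=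
  ∑ i ∈ Finset.range (N + 1), ((i.factorial : ℂ)⁻¹) •
    PowerSeries.coeff N
      ((PowerSeries.mk fun n : ℕ => if h : 0 < n then t ⟨n, h⟩ else 0) ^ i)

/-- The coefficient of `z^N` in `exp (± √(2k) ∑_{n ≥ 1} a_{-n} z^n / n)`; the sign is `σ`. -/
def creationPart (k : ℕ) (c : Chirality) (σ : ℤˣ) (N : ℕ) : Module.End ℂ StateSpace :=
  schur (fun n : ℕ+ =>
    (((σ : ℤ) : ℂ) * (Real.sqrt (2 * k) : ℂ) / ((n : ℕ) : ℂ)) • mode k c (-((n : ℕ) : ℤ))) N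

/-- The coefficient of `z^{-N}` in `exp (∓ √(2k) ∑_{n ≥ 1} a_n z^{-n} / n)`; the sign is `-σ`. -/
def annihilationPart (k : ℕ) (c : Chirality) (σ : ℤˣ) (N : ℕ) : Module.End ℂ StateSpace :=
  schur (fun n : ℕ+ =>
    (-(((σ : ℤ) : ℂ) * (Real.sqrt (2 * k) : ℂ) / ((n : ℕ) : ℂ))) • mode k c ((n : ℕ) : ℤ)) N

/-- The charge shift, which moves `a_0` (for `c = hol`) or `ā_0` (for `c = anti`) by `± √(2k)`,
leaves the zero mode of the other chirality unchanged and commutes with all non-zero modes: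
it sends `|m, n⟩` to `|m + σ, n + σ k⟩`, resp. to `|m + σ, n - σ k⟩`. -/
def chargeShift (k : ℕ) (c : Chirality) (σ : ℤˣ) : Module.End ℂ StateSpace :=
  Finsupp.lmapDomain Fock ℂ fun x => (x.1 + (σ : ℤ), x.2 + (σ : ℤ) * c.sgn * k)

/-- The eigenvalue of `± √(2k) a_0` on the Fock module of `|m, n⟩`, the integer `± (m k ± n)`. -/
def zExponent (k : ℕ) (c : Chirality) (σ : ℤˣ) (x : ℤ × ℤ) : ℤ :=
  (σ : ℤ) * (x.1 * k + c.sgn * x.2)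

theorem coeff_pow_mem (t : ℕ+ → Module.End ℂ StateSpace)
    (ht : ∀ (n : ℕ+) (D : ℤ) (v : StateSpace), v ∈ levelLE D → t n v ∈ levelLE (D - (n : ℕ)))
    (i : ℕ) : ∀ (N : ℕ) (D : ℤ) (v : StateSpace), v ∈ levelLE D →
      PowerSeries.coeff N
        ((PowerSeries.mk fun n : ℕ => if h : 0 < n then t ⟨n, h⟩ else 0) ^ i) v
        ∈ levelLE (D - N) := by
  induction i with
  | zero =>
    intro N D v hv
    rw [pow_zero, PowerSeries.coeff_one]
    split_ifs with h
    · subst h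
      simpa using hv
    · simp
  | succ i ih =>
    intro N D v hv
    rw [pow_succ, PowerSeries.coeff_mul, LinearMap.sum_apply]
    refine Submodule.sum_mem _ ?_
    rintro ⟨a, b⟩ hab
    have hab : a + b = N := Finset.HasAntidiagonal.mem_antidiagonal.1 hab
    simp only [PowerSeries.coeff_mk, Module.End.mul_apply]
    split_ifs with h
    · have h1 := ih a _ _ (ht ⟨b, h⟩ D v hv)
      refine levelLE_mono ?_ h1
      change D - (b : ℤ) - a ≤ D - N
      omega
    · simp

theorem schur_mem (t : ℕ+ → Module.End ℂ StateSpace)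
    (ht : ∀ (n : ℕ+) (D : ℤ) (v : StateSpace), v ∈ levelLE D → t n v ∈ levelLE (D - (n : ℕ)))
    (N : ℕ) {D : ℤ} {v : StateSpace} (hv : v ∈ levelLE D) : schur t N v ∈ levelLE (D - N) := by
  unfold schur
  rw [LinearMap.sum_apply]
  refine Submodule.sum_mem _ fun i _ => ?_
  rw [LinearMap.smul_apply]
  exact Submodule.smul_mem _ _ (coeff_pow_mem t ht i N D v hv)

theorem annihilationPart_mem (k : ℕ) (c : Chirality) (σ : ℤˣ) (N : ℕ) {D : ℤ} {v : StateSpace}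
    (hv : v ∈ levelLE D) : annihilationPart k c σ N v ∈ levelLE (D - N) := by
  unfold annihilationPart
  refine schur_mem _ (fun n D v hv => ?_) N hv
  rw [LinearMap.smul_apply]
  exact Submodule.smul_mem _ _ (mode_pos_mem k c n hv)

/-- One term of `currentOn` below. -/
def currentTerm (k : ℕ) (c : Chirality) (σ : ℤˣ) (r : ℤ) (x : ℤ × ℤ) (j : ℕ) :
    Fock →ₗ[ℂ] StateSpace :=
  if 0 ≤ j - r - k - zExponent k c σ x then
    creationPart k c σ (j - r - k - zExponent k c σ x).toNat ∘ₗ chargeShift k c σ ∘ₗ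
      annihilationPart k c σ j ∘ₗ Finsupp.lsingle x
  else 0

theorem currentTerm_finite (k : ℕ) (c : Chirality) (σ : ℤˣ) (r : ℤ) (x : ℤ × ℤ) (f : Fock) :
    (Function.support fun j : ℕ => currentTerm k c σ r x j f).Finite := by
  obtain ⟨D, hD⟩ := exists_mem_levelLE (Finsupp.single x f)
  refine (Set.finite_Iic D.toNat).subset ?_
  intro j hj
  simp only [Set.mem_Iic]
  by_contra hlt
  apply hj
  have h := annihilationPart_mem k c σ j hD
  rw [levelLE_neg (by omega), Submodule.mem_bot] at h
  simp only [currentTerm]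
  split_ifs
  · simp [h]
  · simp

/-- The mode `J^±_r` on the Fock module of `|m, n⟩`, `x = (m, n)`. If `e` is the eigenvalue of
`± √(2k) a_0`, the mode is the coefficient of `z^{-r-k}` in
`exp (± √(2k) ∑ a_{-n} z^n / n) · (charge shift) · z^e · exp (∓ √(2k) ∑ a_n z^{-n} / n)`:
the terms with `z^i` from the first and `z^{-j}` from the last exponential, `i + e - j = -r-k`. -/
def currentOn (k : ℕ) (c : Chirality) (σ : ℤˣ) (r : ℤ) (x : ℤ × ℤ) : Fock →ₗ[ℂ] StateSpace where
  toFun f := ∑ᶠ j : ℕ, currentTerm k c σ r x j f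
  map_add' f g := by
    simp only [map_add]
    exact finsum_add_distrib (currentTerm_finite k c σ r x f) (currentTerm_finite k c σ r x g)
  map_smul' z f := by
    simp only [map_smul, RingHom.id_apply]
    rw [smul_finsum z]

/-- The mode `J^±_r` (`c = hol`) or `J̄^±_r` (`c = anti`), `r ∈ ℤ`, of the normal ordered
exponential `J^±(z) = :exp (± i √(2k) φ(z)): = ∑_r J^±_r z^{-r-k}` of weight `k`; the sign
is `σ = ±1`. -/
def current (k : ℕ) (c : Chirality) (σ : ℤˣ) (r : ℤ) : Module.End ℂ StateSpace :=
  Finsupp.lsum ℂ (currentOn k c σ r)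

/-! ### The set `S` and the space that it generates -/

/-- The generators of one chirality: `a_i a_j`, `J^+_r + J^-_r` and `a_n (J^+_r - J^-_r)`, with all
mode numbers in `ℤ`. -/
def chiralGenerators (k : ℕ) (c : Chirality) : Set (Module.End ℂ StateSpace) :=
  {T | (∃ i j : ℤ, T = mode k c i * mode k c j) ∨
    (∃ r : ℤ, T = current k c 1 r + current k c (-1) r) ∨
    (∃ n r : ℤ, T = mode k c n * (current k c 1 r - current k c (-1) r))}

/-- The set `S` of generators of the extended symmetry algebra. -/
def generators (k : ℕ) : Set (Module.End ℂ StateSpace) :=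
  chiralGenerators k .hol ∪ chiralGenerators k .anti

/-- The module generated from the state `v` by `S`: all `T v` with `T` in the algebra of operators
generated by `S`. -/
def generatedModule {V : Type*} [AddCommGroup V] [Module ℂ V] (S : Set (Module.End ℂ V)) (v : V) :
    Submodule ℂ V :=
  (Subalgebra.toSubmodule (Algebra.adjoin ℂ S)).map (LinearMap.applyₗ v)

/-! ### The module `H_1` -/

/-- The state `a_{-n_1} ⋯ a_{-n_j} ā_{-m_1} ⋯ ā_{-m_l} v` for the lists `A = [n_1, …, n_j]` and
`B = [m_1, …, m_l]` of positive integers. -/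
def excite (k : ℕ) (A B : List ℕ+) (v : StateSpace) : StateSpace :=
  (A.map fun n => mode k .hol (-((n : ℕ) : ℤ))).prod
    ((B.map fun n => mode k .anti (-((n : ℕ) : ℤ))).prod v)

/-- The span of all states `a_{-n_1} ⋯ a_{-n_j} ā_{-m_1} ⋯ ā_{-m_l} v` in which the number `j` of
unbarred modes has parity `i` and the number `l` of barred modes has parity `i'`
(`0` is even, `1` is odd). -/
def parityFock (k : ℕ) (i i' : ZMod 2) (v : StateSpace) : Submodule ℂ StateSpace :=
  Submodule.span ℂ {w | ∃ A B : List ℕ+, (A.length : ZMod 2) = i ∧ (B.length : ZMod 2) = i' ∧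
    w = excite k A B v}

/-- `H^{Ub}_{s+s', k(s-s')}` for `s, s' > 0`. -/
def HbPair (k : ℕ) (s s' : ℤ) : Submodule ℂ StateSpace :=
  parityFock k 1 1 (ket (s + s') (k * (s - s')) + ket (-(s + s')) (-(k * (s - s')))
      + ket (s - s') (k * (s + s')) + ket (-(s - s')) (-(k * (s + s'))))
  ⊔ parityFock k 0 0 (ket (s + s') (k * (s - s')) + ket (-(s + s')) (-(k * (s - s')))
      - ket (s - s') (k * (s + s')) - ket (-(s - s')) (-(k * (s + s'))))
  ⊔ parityFock k 0 1 (ket (s + s') (k * (s - s')) - ket (-(s + s')) (-(k * (s - s')))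
      + ket (s - s') (k * (s + s')) - ket (-(s - s')) (-(k * (s + s'))))
  ⊔ parityFock k 1 0 (ket (s + s') (k * (s - s')) - ket (-(s + s')) (-(k * (s - s')))
      - ket (s - s') (k * (s + s')) + ket (-(s - s')) (-(k * (s + s'))))

/-- `H^{Ub}_{s, ks}` for `s > 0`. -/
def HbHol (k : ℕ) (s : ℤ) : Submodule ℂ StateSpace :=
  parityFock k 1 1 (ket s (k * s) + ket (-s) (-(k * s)))
  ⊔ parityFock k 0 1 (ket s (k * s) - ket (-s) (-(k * s)))

/-- `H^{Ub}_{s', -ks'}` for `s' > 0`. -/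
def HbAnti (k : ℕ) (s' : ℤ) : Submodule ℂ StateSpace :=
  parityFock k 1 1 (ket s' (-(k * s')) + ket (-s') (k * s'))
  ⊔ parityFock k 1 0 (ket s' (-(k * s')) - ket (-s') (k * s'))

/-- `H^{Ub}_{0,0}`. -/
def HbZero (k : ℕ) : Submodule ℂ StateSpace := parityFock k 1 1 (ket 0 0)

/-- The space `H_1`. -/
def H1 (k : ℕ) : Submodule ℂ StateSpace :=
  (⨆ (s : ℤ) (_ : 0 < s) (s' : ℤ) (_ : 0 < s'), HbPair k s s')
  ⊔ (⨆ (s : ℤ) (_ : 0 < s), HbHol k s)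
  ⊔ (⨆ (s' : ℤ) (_ : 0 < s'), HbAnti k s')
  ⊔ HbZero k

/-! ### Traces and characters -/

/-- `Tr_W (q^{L - c}) = t`, for an operator `L` that is diagonalizable on the subspace `W` with real
eigenvalues of finite multiplicity in `W`: the sum of `q^{μ - c}` over all eigenvalues `μ`, each
weighted by its multiplicity, converges to `t`. -/
def HasTraceQPow {V : Type*} [AddCommGroup V] [Module ℂ V] (L : Module.End ℂ V)
    (W : Submodule ℂ V) (c q t : ℝ) : Prop :=
  W = (⨆ μ : ℝ, W ⊓ L.eigenspace (μ : ℂ)) ∧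
  (∀ μ : ℝ, FiniteDimensional ℂ ↥(W ⊓ L.eigenspace (μ : ℂ))) ∧
  HasSum (fun μ : ℝ => (Module.finrank ℂ ↥(W ⊓ L.eigenspace (μ : ℂ)) : ℝ) * q ^ (μ - c)) t

/-- `η(q) = q^{1/24} ∏_{n ≥ 1} (1 - q^n)`. -/
def eta (q : ℝ) : ℝ := q ^ (1 / 24 : ℝ) * ∏' n : ℕ, (1 - q ^ (n + 1))

/-- `θ_3(q) = ∑_{n ∈ ℤ} q^{n²/2}`. -/
def theta3 (q : ℝ) : ℝ := ∑' n : ℤ, q ^ ((n : ℝ) ^ 2 / 2)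

/-- `θ_4(q) = ∑_{n ∈ ℤ} (-1)^n q^{n²/2}`. -/
def theta4 (q : ℝ) : ℝ := ∑' n : ℤ, (-1 : ℝ) ^ n * q ^ ((n : ℝ) ^ 2 / 2)

/-- `χ_s(q) = ∑_{n ∈ ℤ} q^{k (n + s/(2k))²} / η(q)`. -/
def chi (k : ℕ) (s : ℤ) (q : ℝ) : ℝ :=
  ∑' n : ℤ, q ^ ((k : ℝ) * ((n : ℝ) + (s : ℝ) / (2 * k)) ^ 2) / eta q

/-- `χ_c(q) = √(θ_3(q) θ_4(q)) / η(q)`. -/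
def chiC (q : ℝ) : ℝ := Real.sqrt (theta3 q * theta4 q) / eta q

/-- `χ*_-(q) = ½ (χ_0(q) - χ_c(q))`. -/
def chiStarMinus (k : ℕ) (q : ℝ) : ℝ := (chi k 0 q - chiC q) / 2

end

end OrbifoldBoson

namespace OrbifoldBoson

noncomputable section

open MvPolynomial

/-! ### The modes on the Fock modules -/

/-! Both parts rest on an intrinsic description of $H_1$. The charges reached from $|0,0\rangle$
form the lattice of points $(s\sqrt{2k}, s'\sqrt{2k})$ with $s,s'\in\mathbb Z$ (`loc`). On states
over this lattice each chirality has a reflection `refl`, which changes the sign of its oscillators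
and of its charge and exchanges $J^+$ with $J^-$. Unfolding the blocks shows that $H_1$ is the space
`oddStates` of states odd under both reflections (`H1_eq_oddStates`), spanned by the projections
`oddVec` of monomial states.

(a) The generators are invariant under both reflections, so they preserve `oddStates`
(`chiralGenerators_oddStates`), which contains the initial state. For the converse the two
chiralities are treated one after the other, the other one being a spectator. With $\varphi_s$ the
vacuum of charge $s\sqrt{2k}$, the sum $J^++J^-$ takes $a_{-1}\varphi_0$ to a multiple of
$\varphi_1-\varphi_{-1}$, and takes $\varphi_t-\varphi_{-t}$ to $\varphi_{t+1}-\varphi_{-t-1}$ plus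
states of charge $\pm(t-1)\sqrt{2k}$, which $a_0^2$ separates off (`VacuumFamily.sub_mem`). For
$s\ne0$, $a_{-n}a_0$ adds an oscillator and flips the relative sign of $\varphi_s$ and
$\varphi_{-s}$; for $s=0$, bilinears in the modes produce all words of odd length
(`VacuumFamily.word_sub_mem`). Both chiralities are combined in `excite_mem`.

(b) The vectors `oddVec` with $s,s'\ge0$, and with an odd number of oscillators in a chirality of
zero charge, form an eigenbasis of $L_0+\bar L_0$. Its index set is a product and the energy is
additive, so the trace is the square of a one-chirality sum. With $\Theta=\sum_{n\in\mathbb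
Z}q^{kn^2}$, $Z=\prod(1-q^n)^{-1}$ and $Y=\prod(1+q^n)^{-1}$, that sum is
$q^{-1/24}\bigl(\tfrac{\Theta+1}2Z-\tfrac{Z+Y}2\bigr)=\tfrac12q^{-1/24}(\Theta Z-Y)$
(`hasSum_oddIndex`). Finally $q^{-1/24}Y=\chi_c$ by the Jacobi triple product at $\pm1$ and Euler's
identity (`chiC_eq`). -/

instance : DecidableEq Chirality
  | .hol, .hol => isTrue rfl
  | .hol, .anti => isFalse Chirality.noConfusion
  | .anti, .hol => isFalse Chirality.noConfusion
  | .anti, .anti => isTrue rfl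

theorem fockMode_zero (c : Chirality) (p : ℂ) (f : Fock) : fockMode c p 0 f = p • f := rfl

theorem fockMode_neg (c : Chirality) (p : ℂ) (n : ℕ+) (f : Fock) :
    fockMode c p (-((n : ℕ) : ℤ)) f = X (c, n) * f := by
  obtain ⟨m, rfl⟩ : ∃ m : ℕ, n = m.succPNat := ⟨n.natPred, (PNat.succPNat_natPred n).symm⟩
  rfl

theorem mode_single (k : ℕ) (c : Chirality) (j : ℤ) (x : ℤ × ℤ) (f : Fock) :
    mode k c j (Finsupp.single x f) = Finsupp.single x (fockMode c (charge k c x : ℂ) j f) := by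
  simp [mode]

theorem mode_zero_single (k : ℕ) (c : Chirality) (x : ℤ × ℤ) (f : Fock) :
    mode k c 0 (Finsupp.single x f) = (charge k c x : ℂ) • Finsupp.single x f := by
  rw [mode_single, fockMode_zero, Finsupp.smul_single]

theorem mode_neg_single (k : ℕ) (c : Chirality) (n : ℕ+) (x : ℤ × ℤ) (f : Fock) :
    mode k c (-((n : ℕ) : ℤ)) (Finsupp.single x f) = Finsupp.single x (X (c, n) * f) := by
  rw [mode_single, fockMode_neg]

theorem mode_pos_single (k : ℕ) (c : Chirality) (n : ℕ+) (x : ℤ × ℤ) (f : Fock) :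
    mode k c ((n : ℕ) : ℤ) (Finsupp.single x f)
      = Finsupp.single x (((n : ℕ) : ℂ) • pderiv (c, n) f) := by
  rw [mode_single, fockMode_pos]

theorem int_cases_pnat (j : ℤ) :
    j = 0 ∨ (∃ n : ℕ+, j = ((n : ℕ) : ℤ)) ∨ ∃ n : ℕ+, j = -((n : ℕ) : ℤ) := by
  rcases lt_trichotomy j 0 with h | h | h
  · exact Or.inr (Or.inr ⟨⟨j.natAbs, by omega⟩, by simp [abs_of_neg h]⟩)
  · exact Or.inl h
  · exact Or.inr (Or.inl ⟨⟨j.natAbs, by omega⟩, by simp [abs_of_pos h]⟩)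

/-! ### Schur polynomials of families of operators -/

section Schur

variable {V : Type*} [AddCommGroup V] [Module ℂ V]

/-- An intertwiner of the coefficients can be moved through the product one factor at a time, so the
operators `t n` need not commute. This lets reflections pass through both exponentials of a current.
-/
theorem coeff_pow_intertwine (t t' : ℕ+ → Module.End ℂ V) (T : Module.End ℂ V)
    (h : ∀ n v, t n (T v) = T (t' n v)) (i : ℕ) : ∀ (N : ℕ) (v : V),
      PowerSeries.coeff N
        ((PowerSeries.mk fun n : ℕ => if h : 0 < n then t ⟨n, h⟩ else 0) ^ i) (T v)
      = T (PowerSeries.coeff N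
        ((PowerSeries.mk fun n : ℕ => if h : 0 < n then t' ⟨n, h⟩ else 0) ^ i) v) := by
  induction i with
  | zero =>
    intro N v
    simp only [pow_zero, PowerSeries.coeff_one]
    split_ifs <;> simp
  | succ i ih =>
    intro N v
    simp only [pow_succ, PowerSeries.coeff_mul, LinearMap.sum_apply, map_sum,
      Module.End.mul_apply, PowerSeries.coeff_mk]
    refine Finset.sum_congr rfl fun a _ => ?_
    split_ifs with h0
    · exact (congrArg _ (h _ v)).trans (ih _ _)
    · simp

theorem schur_intertwine (t t' : ℕ+ → Module.End ℂ V) (T : Module.End ℂ V)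
    (h : ∀ n v, t n (T v) = T (t' n v)) (N : ℕ) (v : V) : schur t N (T v) = T (schur t' N v) := by
  simp only [schur, LinearMap.sum_apply, LinearMap.smul_apply, map_sum, map_smul,
    coeff_pow_intertwine t t' T h]

theorem schur_apply_mem (t : ℕ+ → Module.End ℂ V) (W : Submodule ℂ V)
    (h : ∀ n, ∀ v ∈ W, t n v ∈ W) (N : ℕ) (v : V) (hv : v ∈ W) : schur t N v ∈ W := by
  have key : ∀ (i N : ℕ), ∀ v ∈ W, PowerSeries.coeff N
      ((PowerSeries.mk fun n : ℕ => if h : 0 < n then t ⟨n, h⟩ else 0) ^ i) v ∈ W := by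
    intro i
    induction i with
    | zero =>
      intro N v hv
      simp only [pow_zero, PowerSeries.coeff_one]
      split_ifs <;> simp [hv]
    | succ i ih =>
      intro N v hv
      simp only [pow_succ, PowerSeries.coeff_mul, LinearMap.sum_apply,
        Module.End.mul_apply, PowerSeries.coeff_mk]
      refine Submodule.sum_mem _ fun a _ => ?_
      split_ifs with h0
      · exact ih _ _ (h _ _ hv)
      · simp
  simp only [schur, LinearMap.sum_apply, LinearMap.smul_apply]
  exact Submodule.sum_mem _ fun i _ => Submodule.smul_mem _ _ (key i N v hv)

theorem schur_zero (t : ℕ+ → Module.End ℂ V) : schur t 0 = 1 := by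
  simp [schur]

theorem schur_one (t : ℕ+ → Module.End ℂ V) : schur t 1 = t 1 := by
  rw [schur, Finset.sum_range_succ, Finset.sum_range_one]
  simp [PowerSeries.coeff_one]

theorem coeff_pow_succ_apply_eq_zero (t : ℕ+ → Module.End ℂ V) (v : V) (h : ∀ n, t n v = 0)
    (i N : ℕ) : PowerSeries.coeff N
      ((PowerSeries.mk fun n : ℕ => if h : 0 < n then t ⟨n, h⟩ else 0) ^ (i + 1)) v = 0 := by
  simp only [pow_succ, PowerSeries.coeff_mul, LinearMap.sum_apply,
    Module.End.mul_apply, PowerSeries.coeff_mk]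
  refine Finset.sum_eq_zero fun a _ => ?_
  split_ifs with h0
  · exact (congrArg _ (h _)).trans (map_zero _)
  · simp

theorem schur_apply_eq_zero (t : ℕ+ → Module.End ℂ V) (v : V) (h : ∀ n, t n v = 0)
    {N : ℕ} (hN : N ≠ 0) : schur t N v = 0 := by
  simp only [schur, LinearMap.sum_apply, LinearMap.smul_apply]
  refine Finset.sum_eq_zero fun i _ => ?_
  rcases i with _ | i
  · simp [PowerSeries.coeff_one, hN]
  · rw [coeff_pow_succ_apply_eq_zero t v h, smul_zero]

/-- On such a vector the exponential series stops at $v+z\,t_1v$: the factor acting first must be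
$t_1$, and any further factor kills the result. -/
theorem schur_apply_eq_zero_of_two_le (t : ℕ+ → Module.End ℂ V) (v : V)
    (h : ∀ n : ℕ+, n ≠ 1 → t n v = 0) (h' : ∀ n, t n (t 1 v) = 0) {N : ℕ} (hN : 2 ≤ N) :
    schur t N v = 0 := by
  simp only [schur, LinearMap.sum_apply, LinearMap.smul_apply]
  refine Finset.sum_eq_zero fun i _ => ?_
  rcases i with _ | i
  · simp [PowerSeries.coeff_one, show N ≠ 0 by omega]
  rw [pow_succ]
  simp only [PowerSeries.coeff_mul, LinearMap.sum_apply,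
    Module.End.mul_apply, PowerSeries.coeff_mk]
  rw [Finset.sum_eq_zero, smul_zero]
  rintro ⟨a, b⟩ hab
  have hab : a + b = N := Finset.HasAntidiagonal.mem_antidiagonal.1 hab
  split_ifs with h0
  · by_cases hb : b = 1
    · subst hb
      rcases i with _ | i
      · simp [PowerSeries.coeff_one, show a ≠ 0 by omega]
      · exact coeff_pow_succ_apply_eq_zero t _ h' i a
    · rw [h ⟨b, h0⟩ (fun e => hb (congrArg PNat.val e)), map_zero]
  · simp

end Schur

/-! ### The reflections of the two chiralities -/

/-- The algebra automorphism of the Fock module that changes the sign of all oscillators of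
chirality `c`. -/
def flip (c : Chirality) : Fock →ₐ[ℂ] Fock := aeval fun i => if i.1 = c then -X i else X i

/-- The sign by which the oscillators of chirality `c` transform under the reflection of `c'`. -/
def reflSign (c c' : Chirality) : ℤˣ := if c = c' then -1 else 1

theorem flip_X (c c' : Chirality) (n : ℕ+) :
    flip c' (X (c, n)) = ((reflSign c c' : ℤ) : ℂ) • X (c, n) := by
  by_cases h : c = c' <;> simp [flip, reflSign, h]

theorem pderiv_flip (c c' : Chirality) (n : ℕ+) (f : Fock) :
    pderiv (c, n) (flip c' f) = ((reflSign c c' : ℤ) : ℂ) • flip c' (pderiv (c, n) f) := by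
  induction f using MvPolynomial.induction_on with
  | C a => simp [flip]
  | add p q hp hq => simp [hp, hq]
  | mul_X p i ih =>
    obtain ⟨d, m⟩ := i
    rw [map_mul, flip_X, mul_smul_comm, Derivation.map_smul, Derivation.leibniz, ih,
      Derivation.leibniz]
    by_cases h : ((d, m) : Chirality × ℕ+) = (c, n)
    · obtain ⟨rfl, rfl⟩ := Prod.mk.inj h
      rw [pderiv_X_self, map_add, smul_eq_mul, smul_eq_mul, smul_eq_mul, smul_eq_mul, map_mul,
        map_mul, flip_X, map_one]
      simp only [smul_add, mul_one, smul_smul, smul_mul_assoc, mul_smul_comm]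
    · rw [pderiv_X_of_ne h, map_add, smul_eq_mul, smul_eq_mul, smul_eq_mul, smul_eq_mul, map_mul,
        map_mul, flip_X, map_zero]
      simp only [mul_zero, zero_add, smul_smul, smul_mul_assoc, mul_smul_comm]
      rw [mul_comm]

/-- The label of the state to which the reflection of chirality `c` maps `|m, n⟩`. -/
def reflIndex (k : ℕ) (c : Chirality) (x : ℤ × ℤ) : ℤ × ℤ :=
  (-(c.sgn * (x.2 / k)), -(c.sgn * (x.1 * k)))

/-- The reflection `a_j ↦ -a_j` of one chirality, which changes the sign of its charge. It has this
meaning only on states whose winding number is divisible by `k`. -/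
def refl (k : ℕ) (c : Chirality) : Module.End ℂ StateSpace :=
  Finsupp.lsum ℂ fun x => Finsupp.lsingle (reflIndex k c x) ∘ₗ (flip c).toLinearMap

theorem refl_single (k : ℕ) (c : Chirality) (x : ℤ × ℤ) (f : Fock) :
    refl k c (Finsupp.single x f) = Finsupp.single (reflIndex k c x) (flip c f) := by
  simp [refl]

theorem endo_ext {V : Type*} [AddCommGroup V] [Module ℂ V] {S T : StateSpace →ₗ[ℂ] V}
    (h : ∀ x f, S (Finsupp.single x f) = T (Finsupp.single x f)) (v : StateSpace) : S v = T v :=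
  LinearMap.congr_fun (Finsupp.lhom_ext h) v

theorem reflSign_mul_self (c c' : Chirality) :
    ((reflSign c c' : ℤ) : ℂ) * ((reflSign c c' : ℤ) : ℂ) = 1 := by
  unfold reflSign
  split_ifs <;> simp

/-- Nonzero modes do not see the label of the Fock module, so no restriction on the state is needed.
The zero mode does see it, and requires the charge lattice, because `reflIndex` contains an integer
division. -/
theorem mode_refl (k : ℕ) (c c' : Chirality) {j : ℤ} (hj : j ≠ 0) (v : StateSpace) :
    mode k c j (refl k c' v) = ((reflSign c c' : ℤ) : ℂ) • refl k c' (mode k c j v) := by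
  refine endo_ext (S := mode k c j ∘ₗ refl k c')
    (T := ((reflSign c c' : ℤ) : ℂ) • (refl k c' ∘ₗ mode k c j)) (fun x f => ?_) v
  simp only [LinearMap.comp_apply, LinearMap.smul_apply]
  rcases int_cases_pnat j with h | ⟨n, rfl⟩ | ⟨n, rfl⟩
  · exact absurd h hj
  · rw [refl_single, mode_pos_single, mode_pos_single, refl_single, pderiv_flip, map_smul,
      Finsupp.smul_single, smul_comm]
  · rw [refl_single, mode_neg_single, mode_neg_single, refl_single, map_mul, flip_X,
      Finsupp.smul_single, smul_mul_assoc, smul_smul, reflSign_mul_self, one_smul]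

theorem creationPart_refl (k : ℕ) (c c' : Chirality) (σ : ℤˣ) (N : ℕ) (v : StateSpace) :
    creationPart k c σ N (refl k c' v)
      = refl k c' (creationPart k c (reflSign c c' * σ) N v) := by
  refine schur_intertwine _ _ _ (fun n v => ?_) N v
  rw [LinearMap.smul_apply, LinearMap.smul_apply, mode_refl k c c' (by simp), map_smul, smul_smul]
  congr 1
  push_cast
  ring

theorem annihilationPart_refl (k : ℕ) (c c' : Chirality) (σ : ℤˣ) (N : ℕ) (v : StateSpace) :
    annihilationPart k c σ N (refl k c' v)
      = refl k c' (annihilationPart k c (reflSign c c' * σ) N v) := by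
  refine schur_intertwine _ _ _ (fun n v => ?_) N v
  rw [LinearMap.smul_apply, LinearMap.smul_apply, mode_refl k c c' (by simp), map_smul, smul_smul]
  congr 1
  push_cast
  ring

/-- The label of the state to which the charge shift maps `|m, n⟩`. -/
def shiftIndex (k : ℕ) (c : Chirality) (σ : ℤˣ) (x : ℤ × ℤ) : ℤ × ℤ :=
  (x.1 + (σ : ℤ), x.2 + (σ : ℤ) * c.sgn * k)

theorem chargeShift_single (k : ℕ) (c : Chirality) (σ : ℤˣ) (x : ℤ × ℤ) (f : Fock) :
    chargeShift k c σ (Finsupp.single x f) = Finsupp.single (shiftIndex k c σ x) f := by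
  simp [chargeShift, Finsupp.lmapDomain_apply, Finsupp.mapDomain_single, shiftIndex]

/-- A shift changes the winding number by a multiple of $k$, which passes through the integer
division exactly; hence this holds even off the lattice. -/
theorem shiftIndex_reflIndex {k : ℕ} (hk : 0 < k) (c c' : Chirality) (σ : ℤˣ) (x : ℤ × ℤ) :
    shiftIndex k c σ (reflIndex k c' x)
      = reflIndex k c' (shiftIndex k c (reflSign c c' * σ) x) := by
  have hk' : (k : ℤ) ≠ 0 := by exact_mod_cast hk.ne'
  simp only [shiftIndex, reflIndex, Int.add_mul_ediv_right _ _ hk']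
  cases c <;> cases c' <;> simp [reflSign, Chirality.sgn] <;>
    ring_nf <;> simp

theorem chargeShift_refl {k : ℕ} (hk : 0 < k) (c c' : Chirality) (σ : ℤˣ) (v : StateSpace) :
    chargeShift k c σ (refl k c' v) = refl k c' (chargeShift k c (reflSign c c' * σ) v) := by
  refine endo_ext (S := chargeShift k c σ ∘ₗ refl k c')
    (T := refl k c' ∘ₗ chargeShift k c (reflSign c c' * σ)) (fun x f => ?_) v
  simp only [LinearMap.comp_apply, refl_single, chargeShift_single, shiftIndex_reflIndex hk]

/-! ### The charge lattice generated by the currents -/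

/-- The label of the state with charges `s √(2k)` and `s' √(2k)`. -/
def loc (k : ℕ) (s s' : ℤ) : ℤ × ℤ := (s + s', k * (s - s'))

theorem loc_injective {k : ℕ} (hk : 0 < k) {s s' t t' : ℤ} (h : loc k s s' = loc k t t') :
    s = t ∧ s' = t' := by
  have hk' : (k : ℤ) ≠ 0 := by exact_mod_cast hk.ne'
  simp only [loc, Prod.mk.injEq, mul_eq_mul_left_iff, hk', or_false] at h
  omega

theorem reflIndex_hol_loc {k : ℕ} (hk : 0 < k) (s s' : ℤ) :
    reflIndex k .hol (loc k s s') = loc k (-s) s' := by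
  have hk' : (k : ℤ) ≠ 0 := by exact_mod_cast hk.ne'
  simp only [reflIndex, loc, Chirality.sgn, Int.mul_ediv_cancel_left _ hk', Prod.mk.injEq]
  constructor <;> ring

theorem reflIndex_anti_loc {k : ℕ} (hk : 0 < k) (s s' : ℤ) :
    reflIndex k .anti (loc k s s') = loc k s (-s') := by
  have hk' : (k : ℤ) ≠ 0 := by exact_mod_cast hk.ne'
  simp only [reflIndex, loc, Chirality.sgn, Int.mul_ediv_cancel_left _ hk', Prod.mk.injEq]
  constructor <;> ring

theorem shiftIndex_hol_loc (k : ℕ) (σ : ℤˣ) (s s' : ℤ) :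
    shiftIndex k .hol σ (loc k s s') = loc k (s + σ) s' := by
  simp only [shiftIndex, loc, Chirality.sgn, Prod.mk.injEq]
  constructor <;> ring

theorem shiftIndex_anti_loc (k : ℕ) (σ : ℤˣ) (s s' : ℤ) :
    shiftIndex k .anti σ (loc k s s') = loc k s (s' + σ) := by
  simp only [shiftIndex, loc, Chirality.sgn, Prod.mk.injEq]
  constructor <;> ring

theorem zExponent_hol_loc (k : ℕ) (σ : ℤˣ) (s s' : ℤ) :
    zExponent k .hol σ (loc k s s') = σ * (2 * k * s) := by
  simp only [zExponent, loc, Chirality.sgn]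
  ring

theorem zExponent_anti_loc (k : ℕ) (σ : ℤˣ) (s s' : ℤ) :
    zExponent k .anti σ (loc k s s') = σ * (2 * k * s') := by
  simp only [zExponent, loc, Chirality.sgn]
  ring

theorem charge_hol_loc (k : ℕ) (s s' : ℤ) :
    charge k .hol (loc k s s') = s * Real.sqrt (2 * k) := by
  have h : ((2 * k : ℝ)) / Real.sqrt (2 * k) = Real.sqrt (2 * k) := Real.div_sqrt
  simp only [charge, loc, Chirality.sgn]
  push_cast
  calc _ = s * ((2 * k : ℝ) / Real.sqrt (2 * k)) := by ring
    _ = _ := by rw [h]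

theorem charge_anti_loc (k : ℕ) (s s' : ℤ) :
    charge k .anti (loc k s s') = s' * Real.sqrt (2 * k) := by
  have h : ((2 * k : ℝ)) / Real.sqrt (2 * k) = Real.sqrt (2 * k) := Real.div_sqrt
  simp only [charge, loc, Chirality.sgn]
  push_cast
  calc _ = s' * ((2 * k : ℝ) / Real.sqrt (2 * k)) := by ring
    _ = _ := by rw [h]

/-- The labels of the states that the currents can reach from `|0, 0⟩`. -/
def lattice (k : ℕ) : Set (ℤ × ℤ) := {x | ∃ s s', x = loc k s s'}

theorem shiftIndex_mem {k : ℕ} (c : Chirality) (σ : ℤˣ) {x : ℤ × ℤ} (hx : x ∈ lattice k) :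
    shiftIndex k c σ x ∈ lattice k := by
  obtain ⟨s, s', rfl⟩ := hx
  cases c
  · exact ⟨_, _, shiftIndex_hol_loc k σ s s'⟩
  · exact ⟨_, _, shiftIndex_anti_loc k σ s s'⟩

theorem zExponent_reflIndex {k : ℕ} (hk : 0 < k) (c c' : Chirality) (σ : ℤˣ) {x : ℤ × ℤ}
    (hx : x ∈ lattice k) :
    zExponent k c σ (reflIndex k c' x) = zExponent k c (reflSign c c' * σ) x := by
  obtain ⟨s, s', rfl⟩ := hx
  cases c <;> cases c' <;>
    simp [reflIndex_hol_loc hk, reflIndex_anti_loc hk, zExponent_hol_loc, zExponent_anti_loc,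
      reflSign]

theorem charge_reflIndex {k : ℕ} (hk : 0 < k) (c c' : Chirality) {x : ℤ × ℤ}
    (hx : x ∈ lattice k) :
    charge k c (reflIndex k c' x) = (reflSign c c' : ℤ) * charge k c x := by
  obtain ⟨s, s', rfl⟩ := hx
  cases c <;> cases c' <;>
    simp [reflIndex_hol_loc hk, reflIndex_anti_loc hk, charge_hol_loc, charge_anti_loc, reflSign]

theorem charge_shiftIndex {k : ℕ} (hk : 0 < k) (c : Chirality) (σ : ℤˣ) (x : ℤ × ℤ) :
    charge k c (shiftIndex k c σ x) = charge k c x + (σ : ℤ) * Real.sqrt (2 * k) := by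
  have h : (0 : ℝ) < Real.sqrt (2 * k) := by positivity
  have h2 : Real.sqrt (2 * k) * Real.sqrt (2 * k) = 2 * k := Real.mul_self_sqrt (by positivity)
  have h3 : (c.sgn : ℝ) * c.sgn = 1 := by cases c <;> simp [Chirality.sgn]
  simp only [charge, shiftIndex]
  rw [div_add' _ _ _ h.ne', mul_assoc _ (Real.sqrt _) (Real.sqrt _), h2]
  congr 1
  push_cast
  linear_combination ((σ : ℤ) : ℝ) * k * h3

/-! ### The currents on the Fock modules -/

theorem current_single (k : ℕ) (c : Chirality) (σ : ℤˣ) (r : ℤ) (x : ℤ × ℤ) (f : Fock) :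
    current k c σ r (Finsupp.single x f) = ∑ᶠ j : ℕ, currentTerm k c σ r x j f := by
  simp [current, currentOn]

theorem map_supported_mem {V : Type*} [AddCommGroup V] [Module ℂ V] (T : StateSpace →ₗ[ℂ] V)
    (W : Submodule ℂ V) (s : Set (ℤ × ℤ)) (h : ∀ x ∈ s, ∀ f, T (Finsupp.single x f) ∈ W)
    {v : StateSpace} (hv : v ∈ Finsupp.supported Fock ℂ s) : T v ∈ W := by
  rw [← v.sum_single, Finsupp.sum, map_sum]
  exact Submodule.sum_mem _ fun x hx => h x ((Finsupp.mem_supported ℂ v).1 hv hx) _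

theorem map_eq_of_supported {V : Type*} [AddCommGroup V] [Module ℂ V] (S T : StateSpace →ₗ[ℂ] V)
    (s : Set (ℤ × ℤ)) (h : ∀ x ∈ s, ∀ f, S (Finsupp.single x f) = T (Finsupp.single x f))
    {v : StateSpace} (hv : v ∈ Finsupp.supported Fock ℂ s) : S v = T v := by
  have := map_supported_mem (S - T) ⊥ s (fun x hx f => by simp [h x hx f]) hv
  simpa [sub_eq_zero] using this

theorem mode_mem_supported (k : ℕ) (c : Chirality) (j : ℤ) (s : Set (ℤ × ℤ)) (v : StateSpace)
    (hv : v ∈ Finsupp.supported Fock ℂ s) : mode k c j v ∈ Finsupp.supported Fock ℂ s := by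
  refine map_supported_mem _ _ s (fun x hx f => ?_) hv
  rw [mode_single]
  exact Finsupp.single_mem_supported ℂ _ hx

theorem currentTerm_mem (k : ℕ) (c : Chirality) (σ : ℤˣ) (r : ℤ) (x : ℤ × ℤ) (j : ℕ) (f : Fock) :
    currentTerm k c σ r x j f ∈ Finsupp.supported Fock ℂ {shiftIndex k c σ x} := by
  unfold currentTerm
  split_ifs
  · refine schur_apply_mem _ _ (fun n v hv => ?_) _ _ ?_
    · exact Submodule.smul_mem _ _ (mode_mem_supported _ _ _ _ _ hv)
    · refine map_supported_mem (chargeShift k c σ) _ {x} (fun y hy g => ?_)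
        (schur_apply_mem _ _ (fun n v hv => ?_) _ _ (Finsupp.single_mem_supported ℂ f rfl))
      · rw [Set.mem_singleton_iff.1 hy, chargeShift_single]
        exact Finsupp.single_mem_supported ℂ _ rfl
      · exact Submodule.smul_mem _ _ (mode_mem_supported _ _ _ _ _ hv)
  · exact zero_mem _

theorem current_single_mem (k : ℕ) (c : Chirality) (σ : ℤˣ) (r : ℤ) (x : ℤ × ℤ) (f : Fock) :
    current k c σ r (Finsupp.single x f) ∈ Finsupp.supported Fock ℂ {shiftIndex k c σ x} := by
  rw [current_single]
  exact finsum_induction _ (zero_mem _) (fun _ _ => add_mem) fun j => currentTerm_mem k c σ r x j f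

theorem current_mem_lattice (k : ℕ) (c : Chirality) (σ : ℤˣ) (r : ℤ) {v : StateSpace}
    (hv : v ∈ Finsupp.supported Fock ℂ (lattice k)) :
    current k c σ r v ∈ Finsupp.supported Fock ℂ (lattice k) :=
  map_supported_mem (current k c σ r) _ _ (fun _ hx _ => Finsupp.supported_mono
    (Set.singleton_subset_iff.2 (shiftIndex_mem c σ hx)) (current_single_mem ..)) hv

/-- The commutation relation `[a_0, J^±_r] = ± √(2k) J^±_r`. -/
theorem mode_zero_current {k : ℕ} (hk : 0 < k) (c : Chirality) (σ : ℤˣ) (r : ℤ) (v : StateSpace) :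
    mode k c 0 (current k c σ r v) = current k c σ r (mode k c 0 v)
      + (((σ : ℤ) : ℂ) * (Real.sqrt (2 * k) : ℂ)) • current k c σ r v := by
  refine endo_ext (S := mode k c 0 ∘ₗ current k c σ r) (T := current k c σ r ∘ₗ mode k c 0
    + (((σ : ℤ) : ℂ) * (Real.sqrt (2 * k) : ℂ)) • current k c σ r) (fun x f => ?_) v
  simp only [LinearMap.comp_apply, LinearMap.add_apply, LinearMap.smul_apply, mode_zero_single,
    map_smul, ← add_smul]
  -- The image lies in a single Fock module, on which $a_0$ is the scalar given by the shifted
  -- charge.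
  refine map_eq_of_supported (mode k c 0)
    (((charge k c x : ℂ) + ((σ : ℤ) : ℂ) * (Real.sqrt (2 * k) : ℂ)) • LinearMap.id)
    {shiftIndex k c σ x} (fun y hy g => ?_) (current_single_mem k c σ r x f)
  rw [Set.mem_singleton_iff.1 hy, mode_zero_single, charge_shiftIndex hk]
  simp

theorem currentTerm_refl {k : ℕ} (hk : 0 < k) (c c' : Chirality) (σ : ℤˣ) (r : ℤ) {x : ℤ × ℤ}
    (hx : x ∈ lattice k) (j : ℕ) (f : Fock) :
    currentTerm k c σ r (reflIndex k c' x) j (flip c' f)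
      = refl k c' (currentTerm k c (reflSign c c' * σ) r x j f) := by
  simp only [currentTerm, zExponent_reflIndex hk c c' σ hx]
  split_ifs
  · simp only [LinearMap.comp_apply, Finsupp.lsingle_apply]
    rw [← refl_single, annihilationPart_refl, chargeShift_refl hk, creationPart_refl]
  · simp

theorem current_refl {k : ℕ} (hk : 0 < k) (c c' : Chirality) (σ : ℤˣ) (r : ℤ) {v : StateSpace}
    (hv : v ∈ Finsupp.supported Fock ℂ (lattice k)) :
    current k c σ r (refl k c' v) = refl k c' (current k c (reflSign c c' * σ) r v) := by
  refine map_eq_of_supported (current k c σ r ∘ₗ refl k c')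
    (refl k c' ∘ₗ current k c (reflSign c c' * σ) r) _ (fun x hx f => ?_) hv
  simp only [LinearMap.comp_apply, refl_single, current_single, currentTerm_refl hk c c' σ r hx]
  exact ((refl k c').toAddMonoidHom.map_finsum (currentTerm_finite k c _ r x f)).symm

theorem mode_refl_of_lattice {k : ℕ} (hk : 0 < k) (c c' : Chirality) (j : ℤ) {v : StateSpace}
    (hv : v ∈ Finsupp.supported Fock ℂ (lattice k)) :
    mode k c j (refl k c' v) = ((reflSign c c' : ℤ) : ℂ) • refl k c' (mode k c j v) := by
  by_cases hj : j = 0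
  · subst hj
    refine map_eq_of_supported (mode k c 0 ∘ₗ refl k c')
      (((reflSign c c' : ℤ) : ℂ) • (refl k c' ∘ₗ mode k c 0)) _ (fun x hx f => ?_) hv
    simp only [LinearMap.comp_apply, LinearMap.smul_apply, refl_single, mode_zero_single,
      charge_reflIndex hk c c' hx, map_smul, smul_smul]
    congr 1
    push_cast
    ring
  · exact mode_refl k c c' hj v

/-! ### The space of states that are odd under both reflections -/

/-- The states on the charge lattice that are odd under the reflections of both chiralities. -/
def oddStates (k : ℕ) : Submodule ℂ StateSpace where
  carrier := {v | v ∈ Finsupp.supported Fock ℂ (lattice k) ∧ ∀ c, refl k c v = -v}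
  add_mem' := fun ⟨h1, h2⟩ ⟨h3, h4⟩ =>
    ⟨add_mem h1 h3, fun c => by rw [map_add, h2, h4, neg_add]⟩
  zero_mem' := ⟨zero_mem _, fun c => by simp⟩
  smul_mem' := fun z _ ⟨h1, h2⟩ => ⟨Submodule.smul_mem _ z h1, fun c => by
    rw [map_smul, h2, smul_neg]⟩

/-- Under the reflection of the same chirality the two signs of $a_ia_j$ cancel, $J^++J^-$ is fixed,
and the sign of $a_n$ cancels that of $J^+-J^-$. The reflection of the other chirality commutes with
all of these factors. -/
theorem chiralGenerators_oddStates {k : ℕ} (hk : 0 < k) (c : Chirality)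
    {T : Module.End ℂ StateSpace} (hT : T ∈ chiralGenerators k c) {v : StateSpace}
    (hv : v ∈ oddStates k) : T v ∈ oddStates k := by
  have hmode : ∀ (j : ℤ) (w : StateSpace), w ∈ Finsupp.supported Fock ℂ (lattice k) → ∀ c',
      refl k c' (mode k c j w) = ((reflSign c c' : ℤ) : ℂ) • mode k c j (refl k c' w) := by
    intro j w hw c'
    rw [mode_refl_of_lattice hk c c' j hw, smul_smul, reflSign_mul_self, one_smul]
  have hcur : ∀ (σ : ℤˣ) (r : ℤ) (c' : Chirality),
      refl k c' (current k c σ r v) = -current k c (reflSign c c' * σ) r v := by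
    intro σ r c'
    have := current_refl hk c c' (reflSign c c' * σ) r hv.1
    rw [hv.2 c', map_neg, ← mul_assoc, Int.units_mul_self, one_mul] at this
    exact this.symm
  have hdiff : ∀ r c', refl k c' ((current k c 1 r - current k c (-1) r) v)
      = -(((reflSign c c' : ℤ) : ℂ) • (current k c 1 r - current k c (-1) r) v) := by
    intro r c'
    rw [LinearMap.sub_apply, map_sub, hcur, hcur]
    unfold reflSign
    split_ifs <;> simp [add_comm, sub_eq_add_neg]
  rcases hT with ⟨i, j, rfl⟩ | ⟨r, rfl⟩ | ⟨n, r, rfl⟩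
  · refine ⟨mode_mem_supported _ _ _ _ _ (mode_mem_supported _ _ _ _ _ hv.1), fun c' => ?_⟩
    rw [Module.End.mul_apply, hmode _ _ (mode_mem_supported _ _ _ _ _ hv.1), hmode _ _ hv.1,
      hv.2 c', map_smul, smul_smul, reflSign_mul_self, one_smul, map_neg, map_neg]
  · refine ⟨add_mem (current_mem_lattice _ _ _ _ hv.1) (current_mem_lattice _ _ _ _ hv.1),
      fun c' => ?_⟩
    rw [LinearMap.add_apply, map_add, hcur, hcur]
    unfold reflSign
    split_ifs <;> simp [add_comm]
  · have hmem : (current k c 1 r - current k c (-1) r) v ∈ Finsupp.supported Fock ℂ (lattice k) :=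
      sub_mem (current_mem_lattice _ _ _ _ hv.1) (current_mem_lattice _ _ _ _ hv.1)
    refine ⟨mode_mem_supported _ _ _ _ _ hmem, fun c' => ?_⟩
    rw [Module.End.mul_apply, hmode _ _ hmem, hdiff, map_neg, map_smul, smul_neg, smul_smul,
      reflSign_mul_self, one_smul]

end

noncomputable section

open MvPolynomial

/-! ### Words in the creation operators -/

/-- The monomial in the creation operators of chirality `c` with the mode numbers in `A`. -/
def wordPoly (c : Chirality) (A : List ℕ+) : Fock := (A.map fun n => (X (c, n) : Fock)).prod

theorem wordPoly_cons (c : Chirality) (n : ℕ+) (A : List ℕ+) :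
    wordPoly c (n :: A) = X (c, n) * wordPoly c A := by simp [wordPoly]

/-- The operator `a_{-n_1} ⋯ a_{-n_j}` of chirality `c` for `A = [n_1, …, n_j]`. -/
def word (k : ℕ) (c : Chirality) (A : List ℕ+) : Module.End ℂ StateSpace :=
  (A.map fun n => mode k c (-((n : ℕ) : ℤ))).prod

theorem word_cons (k : ℕ) (c : Chirality) (n : ℕ+) (A : List ℕ+) (v : StateSpace) :
    word k c (n :: A) v = mode k c (-((n : ℕ) : ℤ)) (word k c A v) := by simp [word]

theorem word_single (k : ℕ) (c : Chirality) (A : List ℕ+) (x : ℤ × ℤ) (f : Fock) :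
    word k c A (Finsupp.single x f) = Finsupp.single x (wordPoly c A * f) := by
  induction A with
  | nil => simp [word, wordPoly]
  | cons n A ih => rw [word_cons, ih, mode_neg_single, wordPoly_cons, mul_assoc]

theorem excite_eq (k : ℕ) (A B : List ℕ+) (v : StateSpace) :
    excite k A B v = word k .hol A (word k .anti B v) := rfl

theorem flip_wordPoly (c c' : Chirality) (A : List ℕ+) :
    flip c' (wordPoly c A) = ((reflSign c c' : ℤ) : ℂ) ^ A.length • wordPoly c A := by
  induction A with
  | nil => simp [wordPoly]
  | cons n A ih =>
    rw [wordPoly_cons, map_mul, flip_X, ih, smul_mul_smul_comm, List.length_cons, pow_succ']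

theorem word_refl (k : ℕ) (c c' : Chirality) (A : List ℕ+) (v : StateSpace) :
    refl k c' (word k c A v)
      = ((reflSign c c' : ℤ) : ℂ) ^ A.length • word k c A (refl k c' v) := by
  refine endo_ext (S := refl k c' ∘ₗ word k c A)
    (T := ((reflSign c c' : ℤ) : ℂ) ^ A.length • (word k c A ∘ₗ refl k c')) (fun x f => ?_) v
  simp only [LinearMap.comp_apply, LinearMap.smul_apply, word_single, refl_single, map_mul,
    flip_wordPoly, smul_mul_assoc, Finsupp.smul_single]

theorem word_mem_supported (k : ℕ) (c : Chirality) (A : List ℕ+) (s : Set (ℤ × ℤ))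
    {v : StateSpace} (hv : v ∈ Finsupp.supported Fock ℂ s) :
    word k c A v ∈ Finsupp.supported Fock ℂ s := by
  induction A with
  | nil => simpa [word] using hv
  | cons n A ih => rw [word_cons]; exact mode_mem_supported _ _ _ _ _ ih

theorem word_comm (k : ℕ) (A B : List ℕ+) (v : StateSpace) :
    word k .hol A (word k .anti B v) = word k .anti B (word k .hol A v) := by
  refine endo_ext (S := word k .hol A ∘ₗ word k .anti B) (T := word k .anti B ∘ₗ word k .hol A)
    (fun x f => ?_) v
  simp only [LinearMap.comp_apply, word_single, mul_left_comm]

/-! ### Exponents of monomials -/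

/-- The exponent of the monomial whose unbarred and barred parts have exponents `d.1`, `d.2`. -/
def pairExp (d : (ℕ+ →₀ ℕ) × (ℕ+ →₀ ℕ)) : (Chirality × ℕ+) →₀ ℕ :=
  d.1.mapDomain (Prod.mk .hol) + d.2.mapDomain (Prod.mk .anti)

theorem prodMk_injective (c : Chirality) : Function.Injective (Prod.mk c : ℕ+ → Chirality × ℕ+) :=
  Prod.mk_right_injective c

theorem pairExp_hol (d : (ℕ+ →₀ ℕ) × (ℕ+ →₀ ℕ)) (n : ℕ+) : pairExp d (.hol, n) = d.1 n := by
  rw [pairExp, Finsupp.add_apply, Finsupp.mapDomain_apply (prodMk_injective _),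
    Finsupp.mapDomain_of_notMem_range _ _ (by simp), add_zero]

theorem pairExp_anti (d : (ℕ+ →₀ ℕ) × (ℕ+ →₀ ℕ)) (n : ℕ+) : pairExp d (.anti, n) = d.2 n := by
  rw [pairExp, Finsupp.add_apply, Finsupp.mapDomain_apply (prodMk_injective _),
    Finsupp.mapDomain_of_notMem_range _ _ (by simp), zero_add]

theorem pairExp_injective : Function.Injective pairExp := fun d e h =>
  Prod.ext (Finsupp.ext fun n => by rw [← pairExp_hol, h, pairExp_hol])
    (Finsupp.ext fun n => by rw [← pairExp_anti, h, pairExp_anti])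

theorem pairExp_surjective : Function.Surjective pairExp := by
  intro d
  refine ⟨(d.comapDomain _ (prodMk_injective .hol).injOn,
    d.comapDomain _ (prodMk_injective .anti).injOn), Finsupp.ext ?_⟩
  rintro ⟨_ | _, n⟩
  · rw [pairExp_hol, Finsupp.comapDomain_apply]
  · rw [pairExp_anti, Finsupp.comapDomain_apply]

theorem exists_wordPoly (c : Chirality) (d : ℕ+ →₀ ℕ) : ∃ A : List ℕ+, A.length = d.degree ∧
    (monomial (d.mapDomain (Prod.mk c)) 1 : Fock) = wordPoly c A := by
  induction d using Finsupp.induction_linear with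
  | zero => exact ⟨[], by simp, by simp [wordPoly]⟩
  | add d e hd he =>
    obtain ⟨A, hA, hA'⟩ := hd
    obtain ⟨B, hB, hB'⟩ := he
    refine ⟨A ++ B, by simp [hA, hB], ?_⟩
    rw [Finsupp.mapDomain_add, ← one_mul (1 : ℂ), ← monomial_mul, hA', hB']
    simp [wordPoly]
  | single n e =>
    refine ⟨List.replicate e n, by simp, ?_⟩
    rw [Finsupp.mapDomain_single, wordPoly, List.map_replicate, List.prod_replicate,
      X_pow_eq_monomial]

theorem exists_wordPoly_mul (d : (ℕ+ →₀ ℕ) × (ℕ+ →₀ ℕ)) : ∃ A B : List ℕ+,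
    A.length = d.1.degree ∧ B.length = d.2.degree ∧
      (monomial (pairExp d) 1 : Fock) = wordPoly .hol A * wordPoly .anti B := by
  obtain ⟨A, hA, hA'⟩ := exists_wordPoly .hol d.1
  obtain ⟨B, hB, hB'⟩ := exists_wordPoly .anti d.2
  refine ⟨A, B, hA, hB, ?_⟩
  rw [pairExp, ← one_mul (1 : ℂ), ← monomial_mul, hA', hB']

/-! ### The odd states are spanned by projections of monomial states -/

/-- Four times the projection to the states that are odd under both reflections. -/
def oddProj (k : ℕ) : Module.End ℂ StateSpace := (1 - refl k .hol) * (1 - refl k .anti)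

theorem oddProj_of_mem {k : ℕ} {v : StateSpace} (hv : v ∈ oddStates k) :
    oddProj k v = (4 : ℂ) • v := by
  simp only [oddProj, Module.End.mul_apply, LinearMap.sub_apply, Module.End.one_apply, hv.2,
    map_sub, map_neg]
  module

theorem oddProj_single {k : ℕ} (hk : 0 < k) (s s' : ℤ) (f : Fock) {ε ε' : ℂ}
    (h : flip .hol f = ε • f) (h' : flip .anti f = ε' • f) :
    oddProj k (Finsupp.single (loc k s s') f) = Finsupp.single (loc k s s') f
      - ε • Finsupp.single (loc k (-s) s') f - ε' • Finsupp.single (loc k s (-s')) f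
      + (ε * ε') • Finsupp.single (loc k (-s) (-s')) f := by
  have e1 : ∀ t : ℤ, refl k .hol (Finsupp.single (loc k s t) f)
      = ε • Finsupp.single (loc k (-s) t) f := fun t => by
    rw [refl_single, h, reflIndex_hol_loc hk, Finsupp.smul_single]
  have e2 : refl k .anti (Finsupp.single (loc k s s') f)
      = ε' • Finsupp.single (loc k s (-s')) f := by
    rw [refl_single, h', reflIndex_anti_loc hk, Finsupp.smul_single]
  rw [oddProj, Module.End.mul_apply, LinearMap.sub_apply, LinearMap.sub_apply,
    Module.End.one_apply, Module.End.one_apply, e2, map_sub, map_smul, e1, e1]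
  module

theorem flip_hol_wordPoly_mul (A B : List ℕ+) : flip .hol (wordPoly .hol A * wordPoly .anti B)
    = (-1 : ℂ) ^ A.length • (wordPoly .hol A * wordPoly .anti B) := by
  simp [flip_wordPoly, reflSign]

theorem flip_anti_wordPoly_mul (A B : List ℕ+) : flip .anti (wordPoly .hol A * wordPoly .anti B)
    = (-1 : ℂ) ^ B.length • (wordPoly .hol A * wordPoly .anti B) := by
  simp [flip_wordPoly, reflSign]

theorem flip_hol_monomial (d : (ℕ+ →₀ ℕ) × (ℕ+ →₀ ℕ)) :
    flip .hol (monomial (pairExp d) 1) = (-1 : ℂ) ^ d.1.degree • monomial (pairExp d) 1 := by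
  obtain ⟨A, B, hA, hB, h⟩ := exists_wordPoly_mul d
  rw [h, flip_hol_wordPoly_mul, hA]

theorem flip_anti_monomial (d : (ℕ+ →₀ ℕ) × (ℕ+ →₀ ℕ)) :
    flip .anti (monomial (pairExp d) 1) = (-1 : ℂ) ^ d.2.degree • monomial (pairExp d) 1 := by
  obtain ⟨A, B, hA, hB, h⟩ := exists_wordPoly_mul d
  rw [h, flip_anti_wordPoly_mul, hB]

/-- The projection of a monomial state to the odd states. -/
def oddVec (k : ℕ) (s s' : ℤ) (d : (ℕ+ →₀ ℕ) × (ℕ+ →₀ ℕ)) : StateSpace :=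
  oddProj k (Finsupp.single (loc k s s') (monomial (pairExp d) 1))

theorem oddVec_eq {k : ℕ} (hk : 0 < k) (s s' : ℤ) (d : (ℕ+ →₀ ℕ) × (ℕ+ →₀ ℕ)) :
    oddVec k s s' d = Finsupp.single (loc k s s') (monomial (pairExp d) 1)
      - (-1 : ℂ) ^ d.1.degree • Finsupp.single (loc k (-s) s') (monomial (pairExp d) 1)
      - (-1 : ℂ) ^ d.2.degree • Finsupp.single (loc k s (-s')) (monomial (pairExp d) 1)
      + ((-1 : ℂ) ^ d.1.degree * (-1 : ℂ) ^ d.2.degree) •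
        Finsupp.single (loc k (-s) (-s')) (monomial (pairExp d) 1) :=
  oddProj_single hk s s' _ (flip_hol_monomial d) (flip_anti_monomial d)

theorem neg_one_pow_mul_self (n : ℕ) : (-1 : ℂ) ^ n * (-1 : ℂ) ^ n = 1 := by
  rw [← mul_pow]; simp

/-- Replacing $s$ by $-s$ permutes the four terms of the projection up to sign. Hence only $s\ge0$
matters, and for $s=0$ with an even number of oscillators the vector equals its own negative and
vanishes. -/
theorem oddVec_neg_left {k : ℕ} (hk : 0 < k) (s s' : ℤ) (d : (ℕ+ →₀ ℕ) × (ℕ+ →₀ ℕ)) :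
    oddVec k (-s) s' d = -((-1 : ℂ) ^ d.1.degree • oddVec k s s' d) := by
  have h := neg_one_pow_mul_self d.1.degree
  rw [oddVec_eq hk, oddVec_eq hk, neg_neg]
  simp only [smul_add, smul_sub, smul_smul, ← mul_assoc, h, one_smul, one_mul]
  abel

theorem oddVec_neg_right {k : ℕ} (hk : 0 < k) (s s' : ℤ) (d : (ℕ+ →₀ ℕ) × (ℕ+ →₀ ℕ)) :
    oddVec k s (-s') d = -((-1 : ℂ) ^ d.2.degree • oddVec k s s' d) := by
  have h := neg_one_pow_mul_self d.2.degree
  rw [oddVec_eq hk, oddVec_eq hk, neg_neg]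
  simp only [smul_add, smul_sub, smul_smul, mul_comm ((-1 : ℂ) ^ d.1.degree),
    ← mul_assoc, h, one_smul, one_mul]
  abel

/-- The projections of monomial states span the odd states because `oddProj` is multiplication by 4
there. The symmetries under $s\mapsto-s$ and $s'\mapsto-s'$ then cut the spanning set down to the
labels of a basis. -/
theorem oddStates_le {k : ℕ} (hk : 0 < k) (W : Submodule ℂ StateSpace)
    (h : ∀ (s s' : ℕ) (d : (ℕ+ →₀ ℕ) × (ℕ+ →₀ ℕ)), (s = 0 → Odd d.1.degree) →
      (s' = 0 → Odd d.2.degree) → oddVec k s s' d ∈ W) : oddStates k ≤ W := by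
  have h1 : ∀ (s s' : ℕ) (d : (ℕ+ →₀ ℕ) × (ℕ+ →₀ ℕ)), oddVec k s s' d ∈ W := by
    intro s s' d
    by_cases hs : s = 0 → Odd d.1.degree
    · by_cases hs' : s' = 0 → Odd d.2.degree
      · exact h s s' d hs hs'
      · push Not at hs'
        have := oddVec_neg_right hk s s' d
        rw [hs'.1, Nat.cast_zero, neg_zero, (Nat.not_odd_iff_even.1 hs'.2).neg_one_pow, one_smul,
          self_eq_neg] at this
        rw [hs'.1, Nat.cast_zero, this]
        exact zero_mem W
    · push Not at hs
      have := oddVec_neg_left hk s s' d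
      rw [hs.1, Nat.cast_zero, neg_zero, (Nat.not_odd_iff_even.1 hs.2).neg_one_pow, one_smul,
        self_eq_neg] at this
      rw [hs.1, Nat.cast_zero, this]
      exact zero_mem W
  have h2 : ∀ (s s' : ℤ) (d : (ℕ+ →₀ ℕ) × (ℕ+ →₀ ℕ)), oddVec k s s' d ∈ W := by
    intro s s' d
    obtain ⟨n, rfl | rfl⟩ := s.eq_nat_or_neg <;> obtain ⟨n', rfl | rfl⟩ := s'.eq_nat_or_neg
    · exact h1 n n' d
    · rw [oddVec_neg_right hk]
      exact neg_mem (W.smul_mem _ (h1 n n' d))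
    · rw [oddVec_neg_left hk]
      exact neg_mem (W.smul_mem _ (h1 n n' d))
    · rw [oddVec_neg_left hk, oddVec_neg_right hk]
      exact neg_mem (W.smul_mem _ (neg_mem (W.smul_mem _ (h1 n n' d))))
  intro v hv
  have h3 : oddProj k v ∈ W := by
    refine map_supported_mem _ _ _ (fun x hx f => ?_) hv.1
    obtain ⟨s, s', rfl⟩ := hx
    induction f using MvPolynomial.induction_on' with
    | monomial d z =>
      obtain ⟨d, rfl⟩ := pairExp_surjective d
      have e : (Finsupp.single (loc k s s') (monomial (pairExp d) z) : StateSpace)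
          = z • Finsupp.single (loc k s s') (monomial (pairExp d) 1) := by
        rw [Finsupp.smul_single, MvPolynomial.smul_monomial, smul_eq_mul, mul_one]
      rw [e, map_smul]
      exact W.smul_mem _ (h2 s s' d)
    | add f g hf hg =>
      rw [Finsupp.single_add, map_add]
      exact add_mem hf hg
  rw [oddProj_of_mem hv] at h3
  simpa using W.smul_mem (4 : ℂ)⁻¹ h3

/-- The state with charges `s √(2k)` and `s' √(2k)`. -/
def latticeKet (k : ℕ) (s s' : ℤ) : StateSpace := Finsupp.single (loc k s s') 1

theorem refl_hol_latticeKet {k : ℕ} (hk : 0 < k) (s s' : ℤ) :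
    refl k .hol (latticeKet k s s') = latticeKet k (-s) s' := by
  rw [latticeKet, refl_single, reflIndex_hol_loc hk, map_one, latticeKet]

theorem refl_anti_latticeKet {k : ℕ} (hk : 0 < k) (s s' : ℤ) :
    refl k .anti (latticeKet k s s') = latticeKet k s (-s') := by
  rw [latticeKet, refl_single, reflIndex_anti_loc hk, map_one, latticeKet]

theorem latticeKet_mem (k : ℕ) (s s' : ℤ) :
    latticeKet k s s' ∈ Finsupp.supported Fock ℂ (lattice k) :=
  Finsupp.single_mem_supported ℂ _ ⟨s, s', rfl⟩

theorem ket_eq_latticeKet (k : ℕ) {m n s s' : ℤ} (h : (m, n) = loc k s s') :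
    ket m n = latticeKet k s s' := by
  rw [ket, h, latticeKet]

theorem exists_oddVec_eq {k : ℕ} (hk : 0 < k) (s s' : ℤ) (d : (ℕ+ →₀ ℕ) × (ℕ+ →₀ ℕ)) :
    ∃ A B : List ℕ+, A.length = d.1.degree ∧ B.length = d.2.degree ∧
      oddVec k s s' d = excite k A B (latticeKet k s s'
        - (-1 : ℂ) ^ A.length • latticeKet k (-s) s' - (-1 : ℂ) ^ B.length • latticeKet k s (-s')
        + ((-1 : ℂ) ^ A.length * (-1 : ℂ) ^ B.length) • latticeKet k (-s) (-s')) := by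
  obtain ⟨A, B, hA, hB, h⟩ := exists_wordPoly_mul d
  refine ⟨A, B, hA, hB, ?_⟩
  simp only [oddVec_eq hk, excite_eq, hA, hB, h, latticeKet, map_add, map_sub, map_smul,
    word_single, mul_one]

/-! ### Identification of `H_1` -/

theorem neg_one_pow_of_cast_eq {n p : ℕ} (h : (n : ZMod 2) = (p : ZMod 2)) :
    (-1 : ℂ) ^ n = (-1 : ℂ) ^ p := by
  rw [ZMod.natCast_eq_natCast_iff'] at h
  rw [neg_one_pow_eq_pow_mod_two, h, ← neg_one_pow_eq_pow_mod_two]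

/-- Reflecting a word gives one sign per oscillator, so a combination of vacua with the opposite
sign $-(-1)^p$ makes the whole state odd. -/
theorem parityFock_le {k : ℕ} (p p' : ℕ) {w : StateSpace}
    (hw : w ∈ Finsupp.supported Fock ℂ (lattice k))
    (h : refl k .hol w = -((-1 : ℂ) ^ p • w)) (h' : refl k .anti w = -((-1 : ℂ) ^ p' • w)) :
    parityFock k p p' w ≤ oddStates k := by
  refine Submodule.span_le.2 ?_
  rintro _ ⟨A, B, hA, hB, rfl⟩
  refine ⟨word_mem_supported _ _ _ _ (word_mem_supported _ _ _ _ hw), fun c => ?_⟩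
  rw [excite_eq, word_refl, word_refl]
  cases c
  · rw [h, neg_one_pow_of_cast_eq hA.symm]
    simp [reflSign, smul_smul, neg_one_pow_mul_self]
  · rw [h', neg_one_pow_of_cast_eq hB.symm]
    simp [reflSign, smul_smul, neg_one_pow_mul_self]

theorem excite_mem_parityFock (k : ℕ) {p p' : ZMod 2} {A B : List ℕ+}
    (hA : (A.length : ZMod 2) = p) (hB : (B.length : ZMod 2) = p') (v : StateSpace) :
    excite k A B v ∈ parityFock k p p' v := Submodule.subset_span ⟨A, B, hA, hB, rfl⟩

/-! ### Momentum and winding labels in the charge coordinates $(s,s')$ -/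

section Blocks

variable (k : ℕ) (s s' : ℤ)

theorem ket_pos_pos : ket (s + s') (k * (s - s')) = latticeKet k s s' := rfl

theorem ket_neg_neg : ket (-(s + s')) (-(k * (s - s'))) = latticeKet k (-s) (-s') :=
  ket_eq_latticeKet k (by simp only [loc, Prod.mk.injEq]; constructor <;> ring)

theorem ket_pos_neg : ket (s - s') (k * (s + s')) = latticeKet k s (-s') :=
  ket_eq_latticeKet k (by simp only [loc, Prod.mk.injEq]; constructor <;> ring)

theorem ket_neg_pos : ket (-(s - s')) (-(k * (s + s'))) = latticeKet k (-s) s' :=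
  ket_eq_latticeKet k (by simp only [loc, Prod.mk.injEq]; constructor <;> ring)

theorem ket_hol : ket s (k * s) = latticeKet k s 0 :=
  ket_eq_latticeKet k (by simp [loc])

theorem ket_hol_neg : ket (-s) (-(k * s)) = latticeKet k (-s) 0 :=
  ket_eq_latticeKet k (by simp [loc])

theorem ket_anti : ket s (-(k * s)) = latticeKet k 0 s :=
  ket_eq_latticeKet k (by simp [loc])

theorem ket_anti_neg : ket (-s) (k * s) = latticeKet k 0 (-s) :=
  ket_eq_latticeKet k (by simp [loc])

theorem ket_zero : ket 0 0 = latticeKet k 0 0 :=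
  ket_eq_latticeKet k (by simp [loc])

end Blocks

theorem parityFock_le_of_cast {k : ℕ} (p p' : ℕ) {i i' : ZMod 2} {w : StateSpace}
    (hi : (p : ZMod 2) = i) (hi' : (p' : ZMod 2) = i')
    (hw : w ∈ Finsupp.supported Fock ℂ (lattice k))
    (h : refl k .hol w = -((-1 : ℂ) ^ p • w)) (h' : refl k .anti w = -((-1 : ℂ) ^ p' • w)) :
    parityFock k i i' w ≤ oddStates k := by
  subst hi hi'
  exact parityFock_le p p' hw h h'

theorem H1_le_oddStates {k : ℕ} (hk : 0 < k) : H1 k ≤ oddStates k := by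
  have hm := latticeKet_mem k
  refine sup_le (sup_le (sup_le ?_ ?_) ?_) ?_
  · refine iSup₂_le fun s _ => iSup₂_le fun s' _ => ?_
    rw [HbPair, ket_pos_pos, ket_neg_neg, ket_pos_neg, ket_neg_pos]
    refine sup_le (sup_le (sup_le ?_ ?_) ?_) ?_
    · refine parityFock_le_of_cast 1 1 (by simp) (by simp) ?_ ?_ ?_
      · exact add_mem (add_mem (add_mem (hm ..) (hm ..)) (hm ..)) (hm ..)
      · simp [refl_hol_latticeKet hk]; abel
      · simp [refl_anti_latticeKet hk]; abel
    · refine parityFock_le_of_cast 0 0 (by simp) (by simp) ?_ ?_ ?_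
      · exact sub_mem (sub_mem (add_mem (hm ..) (hm ..)) (hm ..)) (hm ..)
      · simp [refl_hol_latticeKet hk]; abel
      · simp [refl_anti_latticeKet hk]; abel
    · refine parityFock_le_of_cast 0 1 (by simp) (by simp) ?_ ?_ ?_
      · exact sub_mem (add_mem (sub_mem (hm ..) (hm ..)) (hm ..)) (hm ..)
      · simp [refl_hol_latticeKet hk]; abel
      · simp [refl_anti_latticeKet hk]; abel
    · refine parityFock_le_of_cast 1 0 (by simp) (by simp) ?_ ?_ ?_
      · exact add_mem (sub_mem (sub_mem (hm ..) (hm ..)) (hm ..)) (hm ..)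
      · simp [refl_hol_latticeKet hk]; abel
      · simp [refl_anti_latticeKet hk]; abel
  · refine iSup₂_le fun s _ => ?_
    rw [HbHol, ket_hol, ket_hol_neg]
    refine sup_le ?_ ?_
    · refine parityFock_le_of_cast 1 1 (by simp) (by simp) (add_mem (hm ..) (hm ..)) ?_ ?_
      · simp [refl_hol_latticeKet hk, add_comm]
      · simp [refl_anti_latticeKet hk, add_comm]
    · refine parityFock_le_of_cast 0 1 (by simp) (by simp) (sub_mem (hm ..) (hm ..)) ?_ ?_
      · simp [refl_hol_latticeKet hk]
      · simp [refl_anti_latticeKet hk]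
  · refine iSup₂_le fun s _ => ?_
    rw [HbAnti, ket_anti, ket_anti_neg]
    refine sup_le ?_ ?_
    · refine parityFock_le_of_cast 1 1 (by simp) (by simp) (add_mem (hm ..) (hm ..)) ?_ ?_
      · simp [refl_hol_latticeKet hk, add_comm]
      · simp [refl_anti_latticeKet hk, add_comm]
    · refine parityFock_le_of_cast 1 0 (by simp) (by simp) (sub_mem (hm ..) (hm ..)) ?_ ?_
      · simp [refl_hol_latticeKet hk]
      · simp [refl_anti_latticeKet hk]
  · rw [HbZero, ket_zero k]
    refine parityFock_le_of_cast 1 1 (by simp) (by simp) (hm ..) ?_ ?_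
    · simp [refl_hol_latticeKet hk]
    · simp [refl_anti_latticeKet hk]

/-- The parities of the two word lengths select the block summand. When a charge vanishes, the four
terms of the projection coincide in pairs, which gives the factor 2 for one zero charge and 4 for
two. -/
theorem oddStates_le_H1 {k : ℕ} (hk : 0 < k) : oddStates k ≤ H1 k := by
  refine oddStates_le hk _ fun s s' d hs hs' => ?_
  obtain ⟨A, B, hA, hB, h⟩ := exists_oddVec_eq hk s s' d
  rw [h]
  rw [← hA] at hs
  rw [← hB] at hs'
  have zo : ∀ {L : List ℕ+}, Odd L.length → (L.length : ZMod 2) = 1 :=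
    fun h => ZMod.natCast_eq_one_iff_odd.2 h
  have ze : ∀ {L : List ℕ+}, Even L.length → (L.length : ZMod 2) = 0 :=
    fun h => ZMod.natCast_eq_zero_iff_even.2 h
  by_cases hs0 : s = 0
  · have hAo := hs hs0
    subst hs0
    by_cases hs0' : s' = 0
    · have hBo := hs' hs0'
      subst hs0'
      refine Submodule.mem_sup_right ?_
      have := (HbZero k).smul_mem 4 (by
        rw [HbZero, ket_zero k]
        exact excite_mem_parityFock k (zo hAo) (zo hBo) (latticeKet k 0 0))
      convert this using 1
      rw [excite_eq, excite_eq, ← map_smul, ← map_smul]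
      congr 2
      simp only [hAo.neg_one_pow, hBo.neg_one_pow, Nat.cast_zero, neg_zero]
      module
    · refine Submodule.mem_sup_left (Submodule.mem_sup_right ?_)
      refine Submodule.mem_iSup_of_mem (s' : ℤ) (Submodule.mem_iSup_of_mem (by omega) ?_)
      rw [HbAnti, ket_anti, ket_anti_neg]
      rcases Nat.even_or_odd B.length with hB' | hB'
      · refine Submodule.mem_sup_right ?_
        convert Submodule.smul_mem _ (2 : ℂ) (excite_mem_parityFock k (zo hAo) (ze hB') _) using 1
        rw [excite_eq, excite_eq, ← map_smul, ← map_smul]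
        congr 2
        simp only [hAo.neg_one_pow, hB'.neg_one_pow, Nat.cast_zero, neg_zero]
        module
      · refine Submodule.mem_sup_left ?_
        convert Submodule.smul_mem _ (2 : ℂ) (excite_mem_parityFock k (zo hAo) (zo hB') _) using 1
        rw [excite_eq, excite_eq, ← map_smul, ← map_smul]
        congr 2
        simp only [hAo.neg_one_pow, hB'.neg_one_pow, Nat.cast_zero, neg_zero]
        module
  · by_cases hs0' : s' = 0
    · have hBo := hs' hs0'
      subst hs0'
      refine Submodule.mem_sup_left (Submodule.mem_sup_left (Submodule.mem_sup_right ?_))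
      refine Submodule.mem_iSup_of_mem (s : ℤ) (Submodule.mem_iSup_of_mem (by omega) ?_)
      rw [HbHol, ket_hol, ket_hol_neg]
      rcases Nat.even_or_odd A.length with hA' | hA'
      · refine Submodule.mem_sup_right ?_
        convert Submodule.smul_mem _ (2 : ℂ) (excite_mem_parityFock k (ze hA') (zo hBo) _) using 1
        rw [excite_eq, excite_eq, ← map_smul, ← map_smul]
        congr 2
        simp only [hA'.neg_one_pow, hBo.neg_one_pow, Nat.cast_zero, neg_zero]
        module
      · refine Submodule.mem_sup_left ?_
        convert Submodule.smul_mem _ (2 : ℂ) (excite_mem_parityFock k (zo hA') (zo hBo) _) using 1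
        rw [excite_eq, excite_eq, ← map_smul, ← map_smul]
        congr 2
        simp only [hA'.neg_one_pow, hBo.neg_one_pow, Nat.cast_zero, neg_zero]
        module
    · refine Submodule.mem_sup_left (Submodule.mem_sup_left (Submodule.mem_sup_left ?_))
      refine Submodule.mem_iSup_of_mem (s : ℤ) (Submodule.mem_iSup_of_mem (by omega)
        (Submodule.mem_iSup_of_mem (s' : ℤ) (Submodule.mem_iSup_of_mem (by omega) ?_)))
      rw [HbPair, ket_pos_pos, ket_neg_neg, ket_pos_neg, ket_neg_pos]
      rcases Nat.even_or_odd A.length with hA' | hA' <;>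
        rcases Nat.even_or_odd B.length with hB' | hB'
      · refine Submodule.mem_sup_left (Submodule.mem_sup_left (Submodule.mem_sup_right ?_))
        convert excite_mem_parityFock k (ze hA') (ze hB') _ using 2
        simp only [hA'.neg_one_pow, hB'.neg_one_pow]
        module
      · refine Submodule.mem_sup_left (Submodule.mem_sup_right ?_)
        convert excite_mem_parityFock k (ze hA') (zo hB') _ using 2
        simp only [hA'.neg_one_pow, hB'.neg_one_pow]
        module
      · refine Submodule.mem_sup_right ?_
        convert excite_mem_parityFock k (zo hA') (ze hB') _ using 2
        simp only [hA'.neg_one_pow, hB'.neg_one_pow]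
        module
      · refine Submodule.mem_sup_left (Submodule.mem_sup_left (Submodule.mem_sup_left ?_))
        convert excite_mem_parityFock k (zo hA') (zo hB') _ using 2
        simp only [hA'.neg_one_pow, hB'.neg_one_pow]
        module

theorem H1_eq_oddStates {k : ℕ} (hk : 0 < k) : H1 k = oddStates k :=
  le_antisymm (H1_le_oddStates hk) (oddStates_le_H1 hk)

end

noncomputable section

open MvPolynomial

/-! ### The currents on vacuum states -/

theorem mode_one_mode_neg_one (k : ℕ) (c : Chirality) (v : StateSpace) :
    mode k c 1 (mode k c (-1) v) = v + mode k c (-1) (mode k c 1 v) := by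
  refine endo_ext (S := mode k c 1 ∘ₗ mode k c (-1))
    (T := LinearMap.id + mode k c (-1) ∘ₗ mode k c 1) (fun x f => ?_) v
  have h1 := fun g => mode_pos_single k c 1 x g
  have h2 := fun g => mode_neg_single k c 1 x g
  simp only [PNat.one_coe, Nat.cast_one] at h1 h2
  simp only [LinearMap.comp_apply, LinearMap.add_apply, LinearMap.id_apply, h1, h2,
    Derivation.leibniz, pderiv_X_self, one_smul, smul_eq_mul, mul_one]
  rw [add_comm, Finsupp.single_add]

theorem mode_zero_mode_neg (k : ℕ) (c : Chirality) (n : ℕ+) (v : StateSpace) :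
    mode k c 0 (mode k c (-((n : ℕ) : ℤ)) v) = mode k c (-((n : ℕ) : ℤ)) (mode k c 0 v) := by
  refine endo_ext (S := mode k c 0 ∘ₗ mode k c (-((n : ℕ) : ℤ)))
    (T := mode k c (-((n : ℕ) : ℤ)) ∘ₗ mode k c 0) (fun x f => ?_) v
  simp only [LinearMap.comp_apply, mode_neg_single, mode_zero_single, map_smul]

theorem mode_zero_word (k : ℕ) (c : Chirality) (A : List ℕ+) (v : StateSpace) :
    mode k c 0 (word k c A v) = word k c A (mode k c 0 v) := by
  induction A with
  | nil => simp [word]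
  | cons n A ih => rw [word_cons, word_cons, mode_zero_mode_neg, ih]

/-- This mode number forces equal powers in the creation and annihilation factors. The latter acts
trivially on a vacuum, so only the bare charge shift survives. -/
theorem current_single_vacuum (k : ℕ) (c : Chirality) (σ : ℤˣ) (x : ℤ × ℤ) (f : Fock)
    (hf : ∀ n, pderiv (c, n) f = 0) :
    current k c σ (-k - zExponent k c σ x) (Finsupp.single x f)
      = Finsupp.single (shiftIndex k c σ x) f := by
  rw [current_single, finsum_eq_single _ 0]
  · rw [currentTerm, if_pos (by simp)]
    simp [creationPart, annihilationPart, schur_zero, chargeShift_single]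
  · intro j hj
    rw [currentTerm]
    split_ifs
    · simp only [LinearMap.comp_apply, Finsupp.lsingle_apply]
      rw [annihilationPart, schur_apply_eq_zero _ _ _ hj, map_zero, map_zero]
      intro n
      rw [LinearMap.smul_apply, mode_pos_single, hf]
      simp
    · rfl

/-- At zero charge the mode $1-k$ pairs annihilation level $j$ with creation level $j-1$. The term
$j=0$ is excluded, the terms $j\ge2$ kill a state with one oscillator $a_{-1}$, and $j=1$ removes
that oscillator with factor $\mp\sqrt{2k}$. -/
theorem current_single_first (k : ℕ) (c : Chirality) (σ : ℤˣ) (x : ℤ × ℤ) (f : Fock)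
    (hx : zExponent k c σ x = 0) (hf : ∀ n, pderiv (c, n) f = 0) :
    current k c σ (1 - k) (Finsupp.single x (X (c, 1) * f))
      = (-(((σ : ℤ) : ℂ) * (Real.sqrt (2 * k) : ℂ))) • Finsupp.single (shiftIndex k c σ x) f := by
  have hd : ∀ n : ℕ+, n ≠ 1 → pderiv (c, n) (X (c, 1) * f) = 0 := fun n hn => by
    rw [Derivation.leibniz, hf, pderiv_X_of_ne (by simpa using hn.symm)]
    simp
  have hd1 : pderiv (c, 1) (X (c, 1) * f) = f := by
    rw [Derivation.leibniz, hf, pderiv_X_self]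
    simp
  rw [current_single, finsum_eq_single _ 1]
  · rw [currentTerm, hx, if_pos (by simp)]
    have h1 := mode_pos_single k c 1 x (X (c, 1) * f)
    rw [hd1] at h1
    simp only [PNat.one_coe, Nat.cast_one, one_smul] at h1
    have h0 : ((1 : ℤ) - (1 - k) - k - 0).toNat = 0 := by simp
    simp only [h0, creationPart, annihilationPart, schur_zero, schur_one, LinearMap.comp_apply,
      Finsupp.lsingle_apply, LinearMap.smul_apply, PNat.one_coe, Nat.cast_one, h1, map_smul,
      chargeShift_single, div_one, Module.End.one_apply]
  · intro j hj
    rw [currentTerm, hx]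
    split_ifs with h
    · simp only [LinearMap.comp_apply, Finsupp.lsingle_apply]
      rw [annihilationPart, schur_apply_eq_zero_of_two_le _ _ _ _ (by omega), map_zero, map_zero]
      · intro n hn
        rw [LinearMap.smul_apply, mode_pos_single, hd n hn]
        simp
      · intro n
        rw [LinearMap.smul_apply, LinearMap.smul_apply, mode_pos_single, hd1, map_smul,
          mode_pos_single, Derivation.map_smul, hf]
        simp
    · rfl

/-! ### Families of vacuum states of one chirality -/

/-- A family of states on which the modes of chirality `c` act as on the highest weight states with
charges `s √(2k)`. -/
structure VacuumFamily (k : ℕ) (c : Chirality) (φ : ℤ → StateSpace) : Prop where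
  mode_pos : ∀ s (n : ℕ+), mode k c ((n : ℕ) : ℤ) (φ s) = 0
  mode_zero : ∀ s, mode k c 0 (φ s) = ((s : ℂ) * (Real.sqrt (2 * k) : ℂ)) • φ s
  current_eq : ∀ (σ : ℤˣ) s, current k c σ (-k - σ * (2 * k * s)) (φ s) = φ (s + σ)
  current_first : ∀ σ : ℤˣ, current k c σ (1 - k) (mode k c (-1) (φ 0))
    = (-(((σ : ℤ) : ℂ) * (Real.sqrt (2 * k) : ℂ))) • φ σ

/-- The defining relations are linear with scalars independent of the family. The second chirality
can therefore be treated on the combinations of states that the first one leaves behind. -/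
theorem VacuumFamily.sub {k : ℕ} {c : Chirality} {φ ψ : ℤ → StateSpace} (hφ : VacuumFamily k c φ)
    (hψ : VacuumFamily k c ψ) : VacuumFamily k c (fun s => φ s - ψ s) where
  mode_pos s n := by rw [map_sub, hφ.mode_pos, hψ.mode_pos, sub_zero]
  mode_zero s := by rw [map_sub, hφ.mode_zero, hψ.mode_zero, smul_sub]
  current_eq σ s := by rw [map_sub, hφ.current_eq, hψ.current_eq]
  current_first σ := by rw [map_sub, map_sub, hφ.current_first, hψ.current_first, smul_sub]

theorem VacuumFamily.smul {k : ℕ} {c : Chirality} {φ : ℤ → StateSpace} (hφ : VacuumFamily k c φ)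
    (z : ℂ) : VacuumFamily k c (fun s => z • φ s) where
  mode_pos s n := by rw [map_smul, hφ.mode_pos, smul_zero]
  mode_zero s := by rw [map_smul, hφ.mode_zero, smul_comm]
  current_eq σ s := by rw [map_smul, hφ.current_eq]
  current_first σ := by rw [map_smul, map_smul, hφ.current_first, smul_comm]

theorem vacuumFamily_hol (k : ℕ) (t : ℤ) (f : Fock) (hf : ∀ n, pderiv (Chirality.hol, n) f = 0) :
    VacuumFamily k .hol (fun s => Finsupp.single (loc k s t) f) where
  mode_pos s n := by rw [mode_pos_single, hf]; simp
  mode_zero s := by rw [mode_zero_single, charge_hol_loc]; push_cast; rfl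
  current_eq σ s := by
    rw [← shiftIndex_hol_loc, ← current_single_vacuum k _ σ _ f hf, zExponent_hol_loc]
  current_first σ := by
    have := mode_neg_single k .hol 1 (loc k 0 t) f
    simp only [PNat.one_coe, Nat.cast_one] at this
    rw [this, current_single_first k _ σ _ f (by simp [zExponent_hol_loc]) hf, shiftIndex_hol_loc,
      zero_add]

theorem vacuumFamily_anti (k : ℕ) (t : ℤ) (f : Fock) (hf : ∀ n, pderiv (Chirality.anti, n) f = 0) :
    VacuumFamily k .anti (fun s => Finsupp.single (loc k t s) f) where
  mode_pos s n := by rw [mode_pos_single, hf]; simp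
  mode_zero s := by rw [mode_zero_single, charge_anti_loc]; push_cast; rfl
  current_eq σ s := by
    rw [← shiftIndex_anti_loc, ← current_single_vacuum k _ σ _ f hf, zExponent_anti_loc]
  current_first σ := by
    have := mode_neg_single k .anti 1 (loc k t 0) f
    simp only [PNat.one_coe, Nat.cast_one] at this
    rw [this, current_single_first k _ σ _ f (by simp [zExponent_anti_loc]) hf,
      shiftIndex_anti_loc, zero_add]

/-- The operator $a_{-n}a_1$ trades $a_{-1}$ for an arbitrary $a_{-n}$, and $a_{-n}a_{-m}$ lengthens
a word by two. -/
theorem VacuumFamily.word_zero_mem {k : ℕ} {c : Chirality} {φ : ℤ → StateSpace}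
    (hφ : VacuumFamily k c φ) (M : Submodule ℂ StateSpace)
    (hM : ∀ T ∈ chiralGenerators k c, ∀ v ∈ M, T v ∈ M) (h : mode k c (-1) (φ 0) ∈ M)
    (A : List ℕ+) (hA : Odd A.length) : word k c A (φ 0) ∈ M := by
  -- The second clause carries the induction through even lengths, where the word itself is not
  -- claimed to lie in `M`.
  have key : ∀ A : List ℕ+, (Odd A.length → word k c A (φ 0) ∈ M) ∧
      (Even A.length → ∀ n, word k c (n :: A) (φ 0) ∈ M) := by
    intro A
    induction A with
    | nil =>
      refine ⟨fun h => by simp at h, fun _ n => ?_⟩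
      have := hM _ (Or.inl ⟨-((n : ℕ) : ℤ), 1, rfl⟩) _ h
      have h1 := hφ.mode_pos 0 1
      simp only [PNat.one_coe, Nat.cast_one] at h1
      rwa [Module.End.mul_apply, mode_one_mode_neg_one, h1, map_zero, add_zero] at this
    | cons m A ih =>
      refine ⟨fun h => ih.2 (by rwa [List.length_cons, Nat.odd_add_one, Nat.not_odd_iff_even] at h)
        m, fun h n => ?_⟩
      rw [word_cons, word_cons]
      rw [List.length_cons, Nat.even_add_one, Nat.not_even_iff_odd] at h
      exact hM _ (Or.inl ⟨-((n : ℕ) : ℤ), -((m : ℕ) : ℤ), rfl⟩) _ (ih.1 h)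
  exact (key A).1 hA

/-- Applying $J^++J^-$ raises the charge but also creates a lower-charge contribution. Since $a_0^2$
is available, an eigenvalue separation removes that contribution without computing it. -/
theorem VacuumFamily.sub_mem {k : ℕ} (hk : 0 < k) {c : Chirality} {φ : ℤ → StateSpace}
    (hφ : VacuumFamily k c φ) (M : Submodule ℂ StateSpace)
    (hM : ∀ T ∈ chiralGenerators k c, ∀ v ∈ M, T v ∈ M) (h : mode k c (-1) (φ 0) ∈ M) (s : ℕ) :
    φ (s + 1) - φ (-(s + 1)) ∈ M := by
  have hR : (Real.sqrt (2 * k) : ℂ) ≠ 0 := by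
    exact_mod_cast (Real.sqrt_pos.2 (by positivity)).ne'
  have hR2 : (Real.sqrt (2 * k) : ℂ) * (Real.sqrt (2 * k) : ℂ) = 2 * k := by
    rw [← Complex.ofReal_mul, Real.mul_self_sqrt (by positivity)]
    push_cast
    rfl
  induction s with
  | zero =>
    have h1 := hM _ (Or.inr (Or.inl ⟨1 - k, rfl⟩)) _ h
    rw [LinearMap.add_apply, hφ.current_first, hφ.current_first] at h1
    convert M.smul_mem (-(Real.sqrt (2 * k) : ℂ)⁻¹) h1 using 1
    simp only [smul_add, smul_smul, Units.val_one, Units.val_neg, Int.cast_one, Int.cast_neg,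
      one_mul, neg_mul, mul_neg, neg_neg, inv_mul_cancel₀ hR, Nat.cast_zero, zero_add]
    module
  | succ s ih =>
    set t : ℤ := s + 1 with ht
    -- One mode number serves both ends: $J^+$ moves $\varphi_t$ to $\varphi_{t+1}$ and $J^-$ moves
    -- $\varphi_{-t}$ to $\varphi_{-t-1}$. The cross terms are `y` and `y'`, of charges
    -- $\pm(t-1)\sqrt{2k}$.
    have h1 := hM _ (Or.inr (Or.inl ⟨-k - 2 * k * t, rfl⟩)) _ ih
    have e1 := hφ.current_eq 1 t
    have e2 := hφ.current_eq (-1) (-t)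
    simp only [Units.val_one, Units.val_neg, one_mul, mul_neg, neg_mul, neg_neg] at e1 e2
    rw [LinearMap.add_apply, map_sub, map_sub, e1, e2] at h1
    set y := current k c (-1) (-k - 2 * k * t) (φ t) with hy
    set y' := current k c 1 (-k - 2 * k * t) (φ (-t)) with hy'
    have z1 : mode k c 0 y = (((t : ℂ) - 1) * (Real.sqrt (2 * k) : ℂ)) • y := by
      rw [hy, mode_zero_current hk, hφ.mode_zero, map_smul, ← add_smul]
      congr 1
      push_cast
      ring
    have z2 : mode k c 0 y' = (-((t : ℂ) - 1) * (Real.sqrt (2 * k) : ℂ)) • y' := by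
      rw [hy', mode_zero_current hk, hφ.mode_zero, map_smul, ← add_smul]
      congr 1
      push_cast
      ring
    have h2 := hM _ (Or.inl ⟨0, 0, rfl⟩) _ h1
    -- The operator $a_0^2-2k(t-1)^2$ kills the cross terms and multiplies the wanted vector by
    -- $2k\bigl((t+1)^2-(t-1)^2\bigr)=8kt$.
    have h3 := M.sub_mem h2 (M.smul_mem (2 * k * ((t : ℂ) - 1) ^ 2) h1)
    have ht0 : (t : ℂ) ≠ 0 := by
      rw [ht]
      push_cast
      exact_mod_cast Nat.succ_ne_zero s
    have hk0 : (k : ℂ) ≠ 0 := by exact_mod_cast hk.ne'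
    convert M.smul_mem (8 * k * (t : ℂ))⁻¹ h3 using 1
    rw [Module.End.mul_apply]
    simp only [map_add, map_sub, z1, z2, hφ.mode_zero, map_smul]
    have e3 : (((s + 1 : ℕ) : ℤ) + 1 : ℤ) = t + 1 := by rw [ht]; push_cast; ring
    have e4 : -t + -1 = -(t + 1) := by ring
    rw [e3, e4, eq_inv_smul_iff₀ (by simp [hk0, ht0])]
    simp only [smul_sub, smul_add, smul_smul]
    push_cast
    simp only [mul_mul_mul_comm _ (Real.sqrt (2 * k) : ℂ), hR2]
    module

/-- For nonzero charge, $a_0$ has opposite eigenvalues on $\varphi_s$ and $\varphi_{-s}$, so each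
$a_{-n}a_0$ both adds an oscillator and flips the relative sign. At zero charge even words cancel
and odd words come from `word_zero_mem`. -/
theorem VacuumFamily.word_sub_mem {k : ℕ} (hk : 0 < k) {c : Chirality} {φ : ℤ → StateSpace}
    (hφ : VacuumFamily k c φ) (M : Submodule ℂ StateSpace)
    (hM : ∀ T ∈ chiralGenerators k c, ∀ v ∈ M, T v ∈ M) (h : mode k c (-1) (φ 0) ∈ M) (s : ℕ)
    (A : List ℕ+) : word k c A (φ s - (-1 : ℂ) ^ A.length • φ (-s)) ∈ M := by
  rcases s with _ | s
  · rcases Nat.even_or_odd A.length with hA | hA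
    · simp [hA.neg_one_pow]
    · have := hφ.word_zero_mem M hM h A hA
      simpa [hA.neg_one_pow] using add_mem this this
  · have hR : (Real.sqrt (2 * k) : ℂ) ≠ 0 := by
      exact_mod_cast (Real.sqrt_pos.2 (by positivity)).ne'
    have hs : (((s + 1 : ℕ) : ℤ) : ℂ) ≠ 0 := by exact_mod_cast Nat.succ_ne_zero s
    induction A with
    | nil =>
      have := hφ.sub_mem hk M hM h s
      simpa [word] using this
    | cons n A ih =>
      have h1 := hM _ (Or.inl ⟨-((n : ℕ) : ℤ), 0, rfl⟩) _ ih
      rw [Module.End.mul_apply, mode_zero_word, ← word_cons, map_sub, map_smul, hφ.mode_zero,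
        hφ.mode_zero] at h1
      convert M.smul_mem ((((s + 1 : ℕ) : ℤ) : ℂ) * (Real.sqrt (2 * k) : ℂ))⁻¹ h1 using 1
      rw [eq_inv_smul_iff₀ (mul_ne_zero hs hR), ← map_smul, List.length_cons]
      congr 1
      push_cast
      module

/-! ### The module generated from `a_{-1} ā_{-1} |0, 0⟩` -/

theorem mem_generatedModule {V : Type*} [AddCommGroup V] [Module ℂ V] (S : Set (Module.End ℂ V))
    (v : V) : v ∈ generatedModule S v :=
  ⟨1, one_mem (Algebra.adjoin ℂ S), rfl⟩

theorem apply_mem_generatedModule {V : Type*} [AddCommGroup V] [Module ℂ V]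
    {S : Set (Module.End ℂ V)} {v : V} {T : Module.End ℂ V} (hT : T ∈ S) {w : V}
    (hw : w ∈ generatedModule S v) : T w ∈ generatedModule S v := by
  obtain ⟨U, hU, rfl⟩ := hw
  exact ⟨T * U, (Algebra.adjoin ℂ S).mul_mem (Algebra.subset_adjoin hT) hU, rfl⟩

theorem generatedModule_le {V : Type*} [AddCommGroup V] [Module ℂ V] {S : Set (Module.End ℂ V)}
    {v : V} (W : Submodule ℂ V) (hv : v ∈ W) (h : ∀ T ∈ S, ∀ w ∈ W, T w ∈ W) :
    generatedModule S v ≤ W := by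
  rintro _ ⟨U, hU, rfl⟩
  rw [LinearMap.applyₗ_apply_apply]
  -- The vector must vary, since in a product the left factor acts on the image under the right one.
  induction hU using Algebra.adjoin_induction generalizing v with
  | mem T hT => exact h T hT _ hv
  | algebraMap z => exact W.smul_mem z hv
  | add T U _ _ hT hU => exact add_mem (hT hv) (hU hv)
  | mul T U _ _ hT hU => exact hT (hU hv)

theorem pderiv_wordPoly {c c' : Chirality} (hc : c ≠ c') (A : List ℕ+) (n : ℕ+) :
    pderiv (c, n) (wordPoly c' A) = 0 := by
  induction A with
  | nil => simp [wordPoly]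
  | cons m A ih =>
    rw [wordPoly_cons, Derivation.leibniz, ih, pderiv_X_of_ne (by simp [hc.symm])]
    simp

/-- The unbarred operators act first, with $\bar a_{-1}$ as spectator. The resulting vectors are the
states $\bar a_{-1}\psi_0$ of a barred vacuum family $\psi$, on which the same argument is repeated.
-/
theorem excite_mem {k : ℕ} (hk : 0 < k) (M : Submodule ℂ StateSpace)
    (hM : ∀ T ∈ generators k, ∀ v ∈ M, T v ∈ M)
    (h : mode k .hol (-1) (mode k .anti (-1) (ket 0 0)) ∈ M) (s s' : ℕ) (A B : List ℕ+) :
    excite k A B (latticeKet k s s'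
        - (-1 : ℂ) ^ A.length • latticeKet k (-s) s' - (-1 : ℂ) ^ B.length • latticeKet k s (-s')
        + ((-1 : ℂ) ^ A.length * (-1 : ℂ) ^ B.length) • latticeKet k (-s) (-s')) ∈ M := by
  have hneg : ∀ (c : Chirality) (v : StateSpace), mode k c (-1) v = word k c [1] v := by
    intro c v
    simp [word]
  have h1 : VacuumFamily k .hol fun s => word k .anti [1] (latticeKet k s 0) := by
    simp only [latticeKet, word_single, mul_one]
    exact vacuumFamily_hol k 0 _ (pderiv_wordPoly (by simp) _)
  have h2 := h1.word_sub_mem hk M (fun T hT => hM T (Or.inl hT)) (by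
    rw [hneg, ket_zero k] at h
    exact h) s A
  -- The unbarred word and the sign combination are constant along the family, and barred
  -- annihilation modes do not see unbarred oscillators.
  have h3 : VacuumFamily k .anti fun s' => word k .hol A (latticeKet k s s')
      - (-1 : ℂ) ^ A.length • word k .hol A (latticeKet k (-s) s') := by
    simp only [latticeKet, word_single, mul_one]
    exact (vacuumFamily_anti k _ _ (pderiv_wordPoly (by simp) _)).sub
      ((vacuumFamily_anti k _ _ (pderiv_wordPoly (by simp) _)).smul _)
  have h4 := h3.word_sub_mem hk M (fun T hT => hM T (Or.inr hT)) (by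
    rw [hneg, map_sub, map_smul, ← word_comm, ← word_comm]
    rwa [map_sub, map_smul] at h2) s' B
  convert h4 using 1
  rw [excite_eq, word_comm]
  congr 1
  simp only [map_add, map_sub, map_smul]
  module

theorem generatedModule_eq_H1 {k : ℕ} (hk : 0 < k) :
    generatedModule (generators k) (mode k .hol (-1) (mode k .anti (-1) (ket 0 0))) = H1 k := by
  rw [H1_eq_oddStates hk]
  refine le_antisymm (generatedModule_le _ ?_ ?_) (oddStates_le hk _ fun s s' d _ _ => ?_)
  · rw [← H1_eq_oddStates hk]
    refine Submodule.mem_sup_right ?_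
    exact Submodule.subset_span ⟨[1], [1], by simp, by simp, by simp [excite]⟩
  · rintro T (hT | hT) w hw
    · exact chiralGenerators_oddStates hk _ hT hw
    · exact chiralGenerators_oddStates hk _ hT hw
  · obtain ⟨A, B, -, -, e⟩ := exists_oddVec_eq hk s s' d
    rw [e]
    exact excite_mem hk _ (fun T hT w hw => apply_mem_generatedModule hT hw)
      (mem_generatedModule _ _) s s' A B

end

noncomputable section

open Filter Topology

/-! ### Generating functions of multi-indices -/

theorem hasSum_mul_real {ι κ : Type*} {f : ι → ℝ} {g : κ → ℝ} {a b : ℝ} (hf : HasSum f a)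
    (hg : HasSum g b) : HasSum (fun x : ι × κ => f x.1 * g x.2) (a * b) := by
  have hf' : Summable fun x => ‖f x‖ := hf.summable.norm
  have hg' : Summable fun x => ‖g x‖ := hg.summable.norm
  have hp : Summable fun x : ι × κ => f x.1 * g x.2 := summable_mul_of_summable_norm hf' hg'
  exact hf.mul hg hp

section MultiIndex

variable {ι : Type*} (f : ι → ℝ)

/-- Splitting off the exponent at the new index `a` multiplies the sum by a geometric series. -/
theorem hasSum_finsupp_prod_finset [DecidableEq ι] (h1 : ∀ n, |f n| < 1) (s : Finset ι) :
    HasSum (fun d : ι →₀ ℕ => if d.support ⊆ s then d.prod fun n e => f n ^ e else 0)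
      (∏ n ∈ s, (1 - f n))⁻¹ := by
  induction s using Finset.induction_on with
  | empty =>
    have := hasSum_single (f := fun d : ι →₀ ℕ =>
      if d.support ⊆ ∅ then d.prod fun n e => f n ^ e else 0) 0
      fun d hd => if_neg fun h => hd (Finsupp.support_eq_empty.1 (Finset.subset_empty.1 h))
    simpa only [Finsupp.support_zero, Finset.Subset.refl, if_true, Finsupp.prod_zero_index,
      Finset.prod_empty, inv_one] using this
  | insert a s ha ih =>
    have hgeo := hasSum_geometric_of_abs_lt_one (h1 a)
    have hprod := hasSum_mul_real hgeo ih
    have hP : (∏ n ∈ insert a s, (1 - f n))⁻¹ = (1 - f a)⁻¹ * (∏ n ∈ s, (1 - f n))⁻¹ :=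
      (congrArg _ (Finset.prod_insert ha)).trans (mul_inv _ _)
    have hF : ∀ (d : ι →₀ ℕ) (e : ℕ), ((d + Finsupp.single a e).prod fun n e => f n ^ e)
        = f a ^ e * d.prod fun n e => f n ^ e := by
      intro d e
      rw [Finsupp.prod_add_index' (by simp) (by simp [pow_add]),
        Finsupp.prod_single_index (by simp), mul_comm]
    have hda : ∀ d : ι →₀ ℕ, d.support ⊆ s → d a = 0 := fun d hd =>
      Finsupp.notMem_support_iff.1 fun h => ha (hd h)
    refine hP ▸ (hasSum_iff_hasSum_of_ne_zero_bij
      (fun x => x.1.2 + Finsupp.single a x.1.1) ?_ ?_ ?_).2 hprod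
    · rintro ⟨⟨e, d⟩, hx⟩ ⟨⟨e', d'⟩, hx'⟩ h
      have hd : d.support ⊆ s := by
        by_contra hc
        simp [hc] at hx
      have hd' : d'.support ⊆ s := by
        by_contra hc
        simp [hc] at hx'
      have he : e = e' := by
        have := DFunLike.congr_fun h a
        simpa [hda d hd, hda d' hd'] using this
      subst he
      simpa using h
    · intro d hd
      have hds : d.support ⊆ insert a s := by
        by_contra hc
        simp [hc] at hd
      have her : (d.erase a).support ⊆ s := by
        rw [Finsupp.support_erase]
        exact fun x hx => (Finset.mem_insert.1 (hds (Finset.mem_of_mem_erase hx))).resolve_left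
          (Finset.ne_of_mem_erase hx)
      refine ⟨⟨(d a, d.erase a), ?_⟩, Finsupp.erase_add_single a d⟩
      rw [Function.mem_support, if_pos hds, ← Finsupp.erase_add_single a d, hF] at hd
      rw [Function.mem_support]
      simpa only [if_pos her] using hd
    · rintro ⟨⟨e, d⟩, hx⟩
      have hd : d.support ⊆ s := by
        by_contra hc
        simp [hc] at hx
      have : (d + Finsupp.single a e).support ⊆ insert a s := by
        refine Finsupp.support_add.trans
          (Finset.union_subset (hd.trans (Finset.subset_insert _ _)) ?_)
        exact Finsupp.support_single_subset.trans (by simp)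
      simp only [this, hd, if_true, hF]

/-- The finite case applied to $|f|$ bounds all partial sums by $\prod(1-|f_n|)^{-1}$ and gives
absolute summability. Dominated convergence along the finite index sets then identifies the value.
-/
theorem hasSum_finsupp_prod (h1 : ∀ n, |f n| < 1) (hs : Summable fun n => |f n|) :
    HasSum (fun d : ι →₀ ℕ => d.prod fun n e => f n ^ e) (∏' n, (1 - f n))⁻¹ := by
  classical
  have hmul : ∀ g : ι → ℝ, (∀ n, |g n| < 1) → (Summable fun n => |g n|) →
      HasProd (fun n => 1 - g n) (∏' n, (1 - g n)) ∧ ∏' n, (1 - g n) ≠ 0 := by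
    intro g hg1 hgs
    have e : ∀ n, 1 - g n = 1 + -g n := fun n => sub_eq_add_neg _ _
    simp only [e]
    refine ⟨(multipliable_one_add_of_summable (by simpa using hgs)).hasProd,
      tprod_one_add_ne_zero_of_summable (fun n => ?_) (by simpa using hgs)⟩
    have := (abs_lt.1 (hg1 n)).2
    linarith
  have habs : ∀ d : ι →₀ ℕ, |d.prod fun n e => f n ^ e| = d.prod fun n e => |f n| ^ e := by
    intro d
    simp only [Finsupp.prod, Finset.abs_prod, abs_pow]
  obtain ⟨hp, hp0⟩ := hmul (fun n => |f n|) (by simpa using h1) (by simpa using hs)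
  have hsum : Summable fun d : ι →₀ ℕ => d.prod fun n e => |f n| ^ e := by
    refine summable_of_sum_le (c := (∏' n, (1 - |f n|))⁻¹) (fun d => ?_) fun u => ?_
    · exact Finset.prod_nonneg fun n _ => by positivity
    · set s := u.biUnion Finsupp.support with hsdef
      have hfin := hasSum_finsupp_prod_finset (fun n => |f n|) (by simpa using h1) s
      have h2 : ∑ d ∈ u, (d.prod fun n e => |f n| ^ e)
          = ∑ d ∈ u, if d.support ⊆ s then (d.prod fun n e => |f n| ^ e) else 0 :=
        Finset.sum_congr rfl fun d hd => by
          rw [if_pos (Finset.subset_biUnion_of_mem Finsupp.support hd)]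
      rw [h2]
      refine (sum_le_hasSum u (fun d _ => ?_) hfin).trans ?_
      · split_ifs
        · exact Finset.prod_nonneg fun n _ => by positivity
        · exact le_rfl
      · have hpos : ∀ t : Finset ι, 0 < ∏ n ∈ t, (1 - |f n|) := fun t =>
          Finset.prod_pos fun n _ => by linarith [h1 n]
        have hle : ∏' n, (1 - |f n|) ≤ ∏ n ∈ s, (1 - |f n|) := by
          refine le_of_tendsto hp ?_
          filter_upwards [eventually_ge_atTop s] with t ht
          rw [← Finset.prod_sdiff ht]
          exact mul_le_of_le_one_left (hpos s).le (Finset.prod_le_one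
            (fun n _ => by linarith [h1 n]) fun n _ => by linarith [abs_nonneg (f n)])
        have h0 : 0 ≤ ∏' n, (1 - |f n|) :=
          ge_of_tendsto hp (Eventually.of_forall fun t => (hpos t).le)
        exact inv_anti₀ (lt_of_le_of_ne h0 hp0.symm) hle
  obtain ⟨hq, hq0⟩ := hmul f h1 hs
  have hsF : Summable fun d : ι →₀ ℕ => d.prod fun n e => f n ^ e := by
    refine Summable.of_norm ?_
    simpa only [Real.norm_eq_abs, habs] using hsum
  have hlim := tendsto_tsum_of_dominated_convergence (𝓕 := (atTop : Filter (Finset ι)))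
    (f := fun s (d : ι →₀ ℕ) => if d.support ⊆ s then d.prod fun n e => f n ^ e else 0)
    (g := fun d => d.prod fun n e => f n ^ e) hsum (fun d => by
      refine tendsto_const_nhds.congr' ?_
      filter_upwards [eventually_ge_atTop d.support] with s hs
      rw [if_pos hs]) (Eventually.of_forall fun s d => by
      rw [← habs]
      split_ifs
      · exact le_rfl
      · simp)
  have hlim2 : Tendsto (fun s : Finset ι => (∏ n ∈ s, (1 - f n))⁻¹) atTop
      (𝓝 (∏' n, (1 - f n))⁻¹) :=
    Filter.Tendsto.inv₀ (show Tendsto (fun s : Finset ι => ∏ n ∈ s, (1 - f n)) atTop _ from hq) hq0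
  rw [← tendsto_nhds_unique (hlim.congr fun s => (hasSum_finsupp_prod_finset f h1 s).tsum_eq) hlim2]
  exact hsF.hasSum

end MultiIndex

/-! ### The Jacobi triple product at `±1` -/

section Theta

variable {q : ℝ}

/-- The finite product `∏_{j=1}^m (1 - q^j)`. -/
def qFactorial (q : ℝ) (m : ℕ) : ℝ := ∏ j ∈ Finset.range m, (1 - q ^ (j + 1))

/-- The infinite product `∏_{j≥1} (1 - q^j)`. -/
def qEuler (q : ℝ) : ℝ := ∏' j : ℕ, (1 - q ^ (j + 1))

theorem qFactorial_succ (q : ℝ) (m : ℕ) :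
    qFactorial q (m + 1) = qFactorial q m * (1 - q ^ (m + 1)) := Finset.prod_range_succ _ _

theorem qFactorial_pos (h0 : 0 < q) (h1 : q < 1) (m : ℕ) : 0 < qFactorial q m :=
  Finset.prod_pos fun j _ => sub_pos.2 (pow_lt_one₀ h0.le h1 (by omega))

theorem summable_pow_linear (h0 : 0 < q) (h1 : q < 1) (a : ℕ) (b : ℕ) :
    Summable fun j : ℕ => q ^ ((a + 1) * j + b) := by
  have e : ∀ j : ℕ, q ^ ((a + 1) * j + b) = (q ^ (a + 1)) ^ j * q ^ b := fun j => by
    rw [pow_add, pow_mul]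
  simp only [e]
  exact (summable_geometric_of_lt_one (by positivity) (pow_lt_one₀ h0.le h1 (by omega))).mul_right _

theorem multipliable_one_add_mul_pow (h0 : 0 < q) (h1 : q < 1) (z : ℝ) (a b : ℕ) :
    Multipliable fun j : ℕ => 1 + z * q ^ ((a + 1) * j + b) :=
  multipliable_one_add_of_summable ((summable_pow_linear h0 h1 a b).mul_left z).norm

theorem multipliable_qEuler (h0 : 0 < q) (h1 : q < 1) :
    Multipliable fun j : ℕ => 1 - q ^ (j + 1) := by
  simpa [sub_eq_add_neg] using multipliable_one_add_mul_pow h0 h1 (-1) 0 1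

theorem qEuler_pos (h0 : 0 < q) (h1 : q < 1) : 0 < qEuler q := by
  refine lt_of_le_of_ne ?_ (Ne.symm ?_)
  · exact ge_of_tendsto (multipliable_qEuler h0 h1).hasProd (Eventually.of_forall fun s =>
      Finset.prod_nonneg fun j _ => sub_nonneg.2 (pow_le_one₀ h0.le h1.le))
  · have := tprod_one_add_ne_zero_of_summable (f := fun j : ℕ => -q ^ (j + 1)) (fun j => by
      have := pow_lt_one₀ h0.le h1 (n := j + 1) (by omega)
      intro h
      linarith) (by simpa [abs_of_pos h0] using summable_pow_linear h0 h1 0 1)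
    simpa [qEuler, sub_eq_add_neg] using this

theorem tendsto_qFactorial (h0 : 0 < q) (h1 : q < 1) :
    Tendsto (qFactorial q) atTop (𝓝 (qEuler q)) :=
  (multipliable_qEuler h0 h1).hasProd.tendsto_prod_nat

theorem antitone_qFactorial (h0 : 0 < q) (h1 : q < 1) : Antitone (qFactorial q) :=
  antitone_nat_of_succ_le fun m => by
    rw [qFactorial_succ]
    exact mul_le_of_le_one_right (qFactorial_pos h0 h1 m).le (by linarith [pow_pos h0 (m + 1)])

theorem qEuler_le_qFactorial (h0 : 0 < q) (h1 : q < 1) (m : ℕ) : qEuler q ≤ qFactorial q m :=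
  (antitone_qFactorial h0 h1).le_of_tendsto (tendsto_qFactorial h0 h1) m

theorem qFactorial_le_one (h0 : 0 < q) (h1 : q < 1) (m : ℕ) : qFactorial q m ≤ 1 := by
  simpa [qFactorial] using antitone_qFactorial h0 h1 (Nat.zero_le m)

/-- The inverse of `∏_{j=1}^m (1 - q^j)`, extended by zero to negative `m`. -/
def qInvFactorial (q : ℝ) (m : ℤ) : ℝ := if 0 ≤ m then (qFactorial q m.toNat)⁻¹ else 0

/-- Extension by zero makes this recursion valid for every integer: at $m=0$ the factor $1-q^0$
vanishes. The triple product then needs no boundary cases. -/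
theorem qInvFactorial_sub_one (h0 : 0 < q) (h1 : q < 1) (m : ℤ) :
    qInvFactorial q (m - 1) = (1 - q ^ m) * qInvFactorial q m := by
  rcases lt_trichotomy m 0 with h | rfl | h
  · simp [qInvFactorial, show ¬ (1 ≤ m) by omega, show ¬ (0 ≤ m) by omega]
  · simp [qInvFactorial]
  · obtain ⟨n, rfl⟩ : ∃ n : ℕ, m = n + 1 := ⟨(m - 1).toNat, by omega⟩
    have e : ((n : ℤ) + 1).toNat = n + 1 := by omega
    have hn := pow_lt_one₀ h0.le h1 (n := n + 1) (by omega)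
    have hz : q ^ ((n : ℤ) + 1) = q ^ (n + 1) := by exact_mod_cast zpow_natCast q (n + 1)
    rw [qInvFactorial, qInvFactorial, if_pos (by omega), if_pos (by omega), e, add_sub_cancel_right,
      Int.toNat_natCast, qFactorial_succ, mul_inv, hz, mul_comm (qFactorial q n)⁻¹,
      mul_inv_cancel_left₀ (by linarith)]

theorem qInvFactorial_nonneg (h0 : 0 < q) (h1 : q < 1) (m : ℤ) : 0 ≤ qInvFactorial q m := by
  unfold qInvFactorial
  split_ifs
  · exact (inv_pos.2 (qFactorial_pos h0 h1 _)).le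
  · exact le_rfl

theorem qInvFactorial_le (h0 : 0 < q) (h1 : q < 1) (m : ℤ) :
    qInvFactorial q m ≤ (qEuler q)⁻¹ := by
  unfold qInvFactorial
  split_ifs
  · exact inv_anti₀ (qEuler_pos h0 h1) (qEuler_le_qFactorial h0 h1 _)
  · exact (inv_pos.2 (qEuler_pos h0 h1)).le

theorem tendsto_qInvFactorial (h0 : 0 < q) (h1 : q < 1) {u : ℕ → ℤ} (hu : Tendsto u atTop atTop) :
    Tendsto (fun N => qInvFactorial q (u N)) atTop (𝓝 (qEuler q)⁻¹) := by
  have h2 : Tendsto (fun N => (u N).toNat) atTop atTop := by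
    refine tendsto_atTop.2 fun b => ?_
    filter_upwards [hu.eventually_ge_atTop (b : ℤ)] with N hN
    omega
  refine (((tendsto_qFactorial h0 h1).comp h2).inv₀ (qEuler_pos h0 h1).ne').congr' ?_
  filter_upwards [hu.eventually_ge_atTop 0] with N hN
  simp [qInvFactorial, hN]

/-- The terms of the finite form of the Jacobi triple product. -/
def tripleTerm (p x : ℝ) (N : ℕ) (n : ℤ) : ℝ :=
  qFactorial (p ^ 2) (2 * N) * qInvFactorial (p ^ 2) (N - n) * qInvFactorial (p ^ 2) (N + n)
    * (p ^ (n ^ 2) * x ^ n)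

/-- This is the coefficient form of multiplying by $(1+xP)(1+x^{-1}P)=1+P^2+xP+x^{-1}P$ with
$P=p^{2N+1}$; the coefficients are Gaussian binomials in $p^2$. -/
theorem tripleTerm_succ {p x : ℝ} (h0 : 0 < p) (h1 : p < 1) (hx : x ≠ 0) (N : ℕ) (n : ℤ) :
    tripleTerm p x (N + 1) n = (1 + (p ^ (2 * N + 1)) ^ 2) * tripleTerm p x N n
      + x * p ^ (2 * N + 1) * tripleTerm p x N (n - 1)
      + x⁻¹ * p ^ (2 * N + 1) * tripleTerm p x N (n + 1) := by
  have hq0 : 0 < p ^ 2 := by positivity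
  have hq1 : p ^ 2 < 1 := pow_lt_one₀ h0.le h1 (by omega)
  have hq := hq0.ne'
  have hI := qInvFactorial_sub_one hq0 hq1
  set q := p ^ 2 with hqdef
  set A := q ^ ((N : ℤ) - n) with hA
  set B := q ^ ((N : ℤ) + n) with hB
  -- All inverse factorials are expressed through the two of largest argument, which reduces the
  -- claim to a polynomial identity in `q`, `A` and `B`.
  set u := qInvFactorial q (N + 1 - n) with hu
  set v := qInvFactorial q (N + 1 + n) with hv
  have a1 : q ^ ((N : ℤ) + 1 - n) = q * A := by
    rw [hA, ← zpow_one_add₀ hq]; congr 1; ring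
  have b1 : q ^ ((N : ℤ) + 1 + n) = q * B := by
    rw [hB, ← zpow_one_add₀ hq]; congr 1; ring
  have i1 : qInvFactorial q (N - n) = (1 - q * A) * u := by
    rw [← a1, ← hI]; congr 1; ring
  have i2 : qInvFactorial q (N + n) = (1 - q * B) * v := by
    rw [← b1, ← hI]; congr 1; ring
  have i3 : qInvFactorial q (N - (n + 1)) = (1 - A) * ((1 - q * A) * u) := by
    rw [← i1, ← hI]; congr 1; ring
  have i4 : qInvFactorial q (N + (n - 1)) = (1 - B) * ((1 - q * B) * v) := by
    rw [← i2, ← hI]; congr 1; ring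
  have i5 : qInvFactorial q (N - (n - 1)) = u := by rw [hu]; congr 1; ring
  have i6 : qInvFactorial q (N + (n + 1)) = v := by rw [hv]; congr 1; ring
  have hAB : q ^ (2 * N + 1) = q * A * B := by
    rw [hA, hB, mul_assoc, ← zpow_add₀ hq, ← zpow_one_add₀ hq, ← zpow_natCast]
    congr 1
    push_cast
    ring
  have hp2 : (p ^ (2 * N + 1)) ^ 2 = q * A * B := by rw [← hAB, hqdef]; ring
  have hF : qFactorial q (2 * (N + 1))
      = qFactorial q (2 * N) * (1 - q * A * B) * (1 - q * (q * A * B)) := by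
    rw [show 2 * (N + 1) = 2 * N + 1 + 1 by ring, qFactorial_succ, qFactorial_succ, ← hAB,
      ← pow_succ']
  -- Completing the square: $2N+1+(n\mp1)^2=n^2+2(N+1\mp n)$, here with the upper sign and in `e2`
  -- with the lower.
  have e1 : p ^ (2 * N + 1) * p ^ ((n - 1) ^ 2) = q * A * p ^ (n ^ 2) := by
    rw [← a1, hqdef, ← zpow_natCast p 2, ← zpow_natCast p (2 * N + 1), ← zpow_mul,
      ← zpow_add₀ h0.ne', ← zpow_add₀ h0.ne']
    congr 1
    push_cast
    ring
  have e2 : p ^ (2 * N + 1) * p ^ ((n + 1) ^ 2) = q * B * p ^ (n ^ 2) := by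
    rw [← b1, hqdef, ← zpow_natCast p 2, ← zpow_natCast p (2 * N + 1), ← zpow_mul,
      ← zpow_add₀ h0.ne', ← zpow_add₀ h0.ne']
    congr 1
    push_cast
    ring
  have x1 : x * x ^ (n - 1) = x ^ n := by rw [← zpow_one_add₀ hx]; congr 1; ring
  have x2 : x⁻¹ * x ^ (n + 1) = x ^ n := by rw [zpow_add_one₀ hx]; field_simp
  have t2 : x * p ^ (2 * N + 1) * tripleTerm p x N (n - 1)
      = qFactorial q (2 * N) * u * ((1 - B) * ((1 - q * B) * v))
        * (q * A * p ^ (n ^ 2) * x ^ n) := by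
    rw [tripleTerm, ← hqdef, i5, i4, ← e1, ← x1]
    ring
  have t3 : x⁻¹ * p ^ (2 * N + 1) * tripleTerm p x N (n + 1)
      = qFactorial q (2 * N) * ((1 - A) * ((1 - q * A) * u)) * v
        * (q * B * p ^ (n ^ 2) * x ^ n) := by
    rw [tripleTerm, ← hqdef, i3, i6, ← e2, ← x2]
    ring
  rw [t2, t3, tripleTerm, tripleTerm, ← hqdef, hF, i1, i2, hp2]
  push_cast
  rw [← hu, ← hv]
  ring

theorem hasSum_tripleTerm {p x : ℝ} (h0 : 0 < p) (h1 : p < 1) (hx : x ≠ 0) (N : ℕ) :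
    HasSum (tripleTerm p x N)
      (∏ j ∈ Finset.range N, ((1 + x * p ^ (2 * j + 1)) * (1 + x⁻¹ * p ^ (2 * j + 1)))) := by
  induction N with
  | zero =>
    have : tripleTerm p x 0 = fun n => if n = 0 then 1 else 0 := by
      funext n
      rcases lt_trichotomy n 0 with h | rfl | h
      · simp [tripleTerm, qInvFactorial, show ¬ 0 ≤ n by omega, h.ne]
      · simp [tripleTerm, qInvFactorial, qFactorial]
      · simp [tripleTerm, qInvFactorial, show ¬ n ≤ 0 by omega, h.ne']
    rw [this]
    simpa using hasSum_ite_eq (0 : ℤ) (1 : ℝ)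
  | succ N ih =>
    have h2 := ((Equiv.subRight (1 : ℤ)).hasSum_iff (f := tripleTerm p x N)).2 ih
    have h3 := ((Equiv.addRight (1 : ℤ)).hasSum_iff (f := tripleTerm p x N)).2 ih
    have h4 := ((ih.mul_left (1 + (p ^ (2 * N + 1)) ^ 2)).add
      (h2.mul_left (x * p ^ (2 * N + 1)))).add (h3.mul_left (x⁻¹ * p ^ (2 * N + 1)))
    have e : tripleTerm p x (N + 1) = fun n => (1 + (p ^ (2 * N + 1)) ^ 2) * tripleTerm p x N n
      + x * p ^ (2 * N + 1) * tripleTerm p x N (n - 1)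
      + x⁻¹ * p ^ (2 * N + 1) * tripleTerm p x N (n + 1) :=
      funext (tripleTerm_succ h0 h1 hx N)
    rw [e, Finset.prod_range_succ]
    have e' : ∀ y P : ℝ, y * ((1 + x * P) * (1 + x⁻¹ * P))
        = (1 + P ^ 2) * y + x * P * y + x⁻¹ * P * y := fun y P => by
      linear_combination y * P ^ 2 * mul_inv_cancel₀ hx
    rw [e']
    exact h4

theorem summable_zpow_sq {p : ℝ} (h0 : 0 < p) (h1 : p < 1) :
    Summable fun n : ℤ => p ^ (n ^ 2) := by
  have h : Summable fun n : ℕ => p ^ (n ^ 2) :=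
    (summable_geometric_of_lt_one h0.le h1).of_nonneg_of_le (fun n => by positivity)
      fun n => pow_le_pow_of_le_one h0.le h1.le (Nat.le_self_pow two_ne_zero n)
  have e : ∀ n : ℕ, p ^ ((n : ℤ) ^ 2) = p ^ (n ^ 2) := fun n => by
    rw [← zpow_natCast]; push_cast; rfl
  refine Summable.of_nat_of_neg ?_ ?_
  · simpa only [e] using h
  · simpa only [neg_sq, e] using h

/-- The Jacobi triple product identity at `x = ±1`. -/
theorem tsum_zpow_sq {p x : ℝ} (h0 : 0 < p) (h1 : p < 1) (hx : x * x = 1) :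
    ∑' n : ℤ, p ^ (n ^ 2) * x ^ n
      = qEuler (p ^ 2) * (∏' j : ℕ, (1 + x * p ^ (2 * j + 1))) ^ 2 := by
  have hq0 : 0 < p ^ 2 := by positivity
  have hq1 : p ^ 2 < 1 := pow_lt_one₀ h0.le h1 (by omega)
  have hx0 : x ≠ 0 := fun h => by simp [h] at hx
  have hinv : x⁻¹ = x := inv_eq_of_mul_eq_one_right hx
  have habs : |x| = 1 := by
    have : |x| * |x| = 1 := by rw [← abs_mul, hx, abs_one]
    nlinarith [abs_nonneg x]
  have hE := qEuler_pos hq0 hq1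
  have hm := multipliable_one_add_mul_pow h0 h1 x 1 1
  have hlim1 : Tendsto (fun N : ℕ => ∑' n, tripleTerm p x N n) atTop
      (𝓝 ((∏' j : ℕ, (1 + x * p ^ (2 * j + 1))) ^ 2)) := by
    refine (hm.hasProd.tendsto_prod_nat.pow 2).congr fun N => ?_
    rw [(hasSum_tripleTerm h0 h1 hx0 N).tsum_eq, hinv, Finset.prod_mul_distrib, sq]
  have hlim2 : Tendsto (fun N : ℕ => ∑' n, tripleTerm p x N n) atTop
      (𝓝 (∑' n : ℤ, qEuler (p ^ 2) * (qEuler (p ^ 2))⁻¹ * (qEuler (p ^ 2))⁻¹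
        * (p ^ (n ^ 2) * x ^ n))) := by
    -- For fixed $n$ the Gaussian binomial tends to $E\cdot E^{-1}\cdot E^{-1}$ with
    -- $E=\prod_{j\ge1}(1-p^{2j})$. It is at most $E^{-2}$ uniformly in $N$, and $p^{n^2}$ is
    -- summable.
    refine tendsto_tsum_of_dominated_convergence
      (bound := fun n : ℤ => 1 * (qEuler (p ^ 2))⁻¹ * (qEuler (p ^ 2))⁻¹ * p ^ (n ^ 2))
      ((summable_zpow_sq h0 h1).mul_left _) (fun n => ?_) (Eventually.of_forall fun N n => ?_)
    · refine Tendsto.mul_const _ (Tendsto.mul (Tendsto.mul ?_ ?_) ?_)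
      · exact (tendsto_qFactorial hq0 hq1).comp (tendsto_id.const_mul_atTop' (by omega))
      · exact tendsto_qInvFactorial hq0 hq1
          (tendsto_atTop_add_const_right _ (-n) tendsto_natCast_atTop_atTop)
      · exact tendsto_qInvFactorial hq0 hq1
          (tendsto_atTop_add_const_right _ n tendsto_natCast_atTop_atTop)
    · have i1 := qInvFactorial_nonneg hq0 hq1 (N - n)
      have i2 := qInvFactorial_nonneg hq0 hq1 (N + n)
      have i3 := (qFactorial_pos hq0 hq1 (2 * N)).le
      have i4 : 0 ≤ (qEuler (p ^ 2))⁻¹ := (inv_pos.2 hE).le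
      rw [tripleTerm, Real.norm_eq_abs, abs_mul, abs_mul, abs_mul, abs_mul, abs_of_nonneg i1,
        abs_of_nonneg i2, abs_of_nonneg i3, abs_zpow x, habs, one_zpow, mul_one,
        abs_of_pos (zpow_pos h0 _)]
      gcongr
      · exact qFactorial_le_one hq0 hq1 _
      · exact qInvFactorial_le hq0 hq1 _
      · exact qInvFactorial_le hq0 hq1 _
  have h := tendsto_nhds_unique hlim2 hlim1
  rw [tsum_mul_left, mul_inv_cancel₀ hE.ne', one_mul] at h
  rw [← h, mul_inv_cancel_left₀ hE.ne']

/-- The product `∏_{j≥0} (1 - q^{2j+1})`. -/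
def qOdd (q : ℝ) : ℝ := ∏' j : ℕ, (1 - q ^ (2 * j + 1))

theorem qOdd_nonneg (h0 : 0 < q) (h1 : q < 1) : 0 ≤ qOdd q := by
  have hm : Multipliable fun j : ℕ => 1 - q ^ (2 * j + 1) := by
    simpa [sub_eq_add_neg] using multipliable_one_add_mul_pow h0 h1 (-1) 1 1
  exact ge_of_tendsto hm.hasProd (Eventually.of_forall fun s =>
      Finset.prod_nonneg fun j _ => sub_nonneg.2 (pow_le_one₀ h0.le h1.le))

/-- Euler's identity `∏ (1 - q^{2j+1}) ∏ (1 + q^{j+1}) = 1`. -/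
theorem qOdd_eq (h0 : 0 < q) (h1 : q < 1) : qOdd q = (∏' j : ℕ, (1 + q ^ (j + 1)))⁻¹ := by
  have hodd : Multipliable fun j : ℕ => 1 - q ^ (2 * j + 1) := by
    simpa [sub_eq_add_neg] using multipliable_one_add_mul_pow h0 h1 (-1) 1 1
  have heven : Multipliable fun j : ℕ => 1 - q ^ (2 * j + 1 + 1) := by
    simpa [sub_eq_add_neg] using multipliable_one_add_mul_pow h0 h1 (-1) 1 2
  have hplus : Multipliable fun j : ℕ => 1 + q ^ (j + 1) := by
    simpa using multipliable_one_add_mul_pow h0 h1 1 0 1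
  have e1 : qOdd q * ∏' j : ℕ, (1 - q ^ (2 * j + 1 + 1)) = qEuler q :=
    tprod_even_mul_odd (f := fun j => 1 - q ^ (j + 1)) hodd heven
  have e2 : ∏' j : ℕ, (1 - q ^ (2 * j + 1 + 1)) = qEuler q * ∏' j : ℕ, (1 + q ^ (j + 1)) := by
    rw [qEuler, ← (multipliable_qEuler h0 h1).tprod_mul hplus]
    refine tprod_congr fun j => ?_
    ring
  have hE := (qEuler_pos h0 h1).ne'
  rw [e2] at e1
  refine eq_inv_of_mul_eq_one_left ?_
  refine mul_left_cancel₀ hE ?_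
  linear_combination e1

/-- With $p=\sqrt q$ the two theta functions are the triple products at $x=1$ and $x=-1$, and
$(1+p^m)(1-p^m)=1-q^m$. -/
theorem theta3_mul_theta4 (h0 : 0 < q) (h1 : q < 1) :
    theta3 q * theta4 q = (qEuler q * qOdd q) ^ 2 := by
  obtain ⟨p, hp0, hp⟩ : ∃ p : ℝ, 0 < p ∧ q = p ^ 2 :=
    ⟨Real.sqrt q, Real.sqrt_pos.2 h0, (Real.sq_sqrt h0.le).symm⟩
  have hp1 : p < 1 := by
    by_contra h
    have : 1 ≤ p ^ 2 := one_le_pow₀ (not_lt.1 h)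
    linarith
  have hterm : ∀ n : ℤ, q ^ ((n : ℝ) ^ 2 / 2) = p ^ (n ^ 2) := by
    intro n
    rw [hp, ← Real.rpow_natCast p 2, ← Real.rpow_mul hp0.le, ← Real.rpow_intCast]
    congr 1
    push_cast
    ring
  have e3 : theta3 q = qEuler q * (∏' j : ℕ, (1 + 1 * p ^ (2 * j + 1))) ^ 2 := by
    rw [hp, ← tsum_zpow_sq hp0 hp1 (one_mul 1), ← hp, theta3]
    simp only [hterm, one_zpow, mul_one]
  have e4 : theta4 q = qEuler q * (∏' j : ℕ, (1 + (-1) * p ^ (2 * j + 1))) ^ 2 := by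
    rw [hp, ← tsum_zpow_sq hp0 hp1 (by norm_num), ← hp, theta4]
    simp only [hterm, mul_comm]
  have em : (∏' j : ℕ, (1 + 1 * p ^ (2 * j + 1))) * ∏' j : ℕ, (1 + (-1) * p ^ (2 * j + 1))
      = qOdd q := by
    rw [← (multipliable_one_add_mul_pow hp0 hp1 1 1 1).tprod_mul
      (multipliable_one_add_mul_pow hp0 hp1 (-1) 1 1), qOdd, hp]
    refine tprod_congr fun j => ?_
    ring
  rw [e3, e4, ← em]
  ring

theorem eta_eq (q : ℝ) : eta q = q ^ (1 / 24 : ℝ) * qEuler q := rfl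

/-- The product $\theta_3\theta_4$ is the square of a nonnegative quantity, so its root is explicit.
Euler's identity turns the odd product into the signed count of oscillator states at zero charge. -/
theorem chiC_eq (h0 : 0 < q) (h1 : q < 1) :
    chiC q = q ^ (-(1 / 24 : ℝ)) * (∏' j : ℕ, (1 + q ^ (j + 1)))⁻¹ := by
  have hE := qEuler_pos h0 h1
  rw [chiC, theta3_mul_theta4 h0 h1, Real.sqrt_sq (mul_nonneg hE.le (qOdd_nonneg h0 h1)), eta_eq,
    ← qOdd_eq h0 h1, Real.rpow_neg h0.le]
  have := (Real.rpow_pos_of_pos h0 (1 / 24 : ℝ)).ne'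
  field_simp

end Theta

end

noncomputable section

open MvPolynomial Filter Topology

/-! ### The character of one chirality -/

/-- The level of the multi-index `d`. -/
def chiralLevel (d : ℕ+ →₀ ℕ) : ℕ := d.sum fun n e => e * (n : ℕ)

/-- The labels `(s, d)` of a basis of the odd states of one chirality. -/
abbrev OddIndex : Type := {x : ℕ × (ℕ+ →₀ ℕ) // x.1 = 0 → Odd x.2.degree}

/-- The energy of the basis state with label `(s, d)`. -/
def OddIndex.energy (k : ℕ) (x : OddIndex) : ℕ := k * x.1.1 ^ 2 + chiralLevel x.1.2

section Character

variable {q : ℝ}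

/-- The summand is $\prod_n(zq^n)^{e_n}$. The value $z=1$ counts oscillator states and $z=-1$ counts
them with the reflection sign. -/
theorem hasSum_level_of_sign (h0 : 0 < q) (h1 : q < 1) {z : ℝ} (hz : |z| = 1) :
    HasSum (fun d : ℕ+ →₀ ℕ => z ^ d.degree * q ^ chiralLevel d)
      (∏' j : ℕ, (1 - z * q ^ (j + 1)))⁻¹ := by
  have habs : ∀ n : ℕ+, |z * q ^ (n : ℕ)| = q ^ (n : ℕ) := fun n => by
    rw [abs_mul, hz, one_mul, abs_of_pos (pow_pos h0 _)]
  have h := hasSum_finsupp_prod (fun n : ℕ+ => z * q ^ (n : ℕ))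
    (fun n => by rw [habs]; exact pow_lt_one₀ h0.le h1 n.ne_zero)
    (by
      simp only [habs]
      exact (summable_geometric_of_lt_one h0.le h1).comp_injective PNat.coe_injective)
  rw [← tprod_pnat_eq_tprod_succ (f := fun n : ℕ => 1 - z * q ^ n)]
  convert h using 2 with d
  rw [Finsupp.degree_apply, chiralLevel, Finsupp.sum, Finsupp.prod,
    ← Finset.prod_pow_eq_pow_sum, ← Finset.prod_pow_eq_pow_sum, ← Finset.prod_mul_distrib]
  refine Finset.prod_congr rfl fun n _ => ?_
  rw [mul_pow, ← pow_mul, mul_comm (n : ℕ)]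

theorem summable_theta (h0 : 0 < q) (h1 : q < 1) {k : ℕ} (hk : 0 < k) :
    Summable fun n : ℤ => q ^ (k * n.natAbs ^ 2) := by
  have h := summable_zpow_sq (pow_pos h0 k) (pow_lt_one₀ h0.le h1 hk.ne')
  refine h.congr fun n => ?_
  have e : n ^ 2 = ((n.natAbs ^ 2 : ℕ) : ℤ) := by
    push_cast
    exact (sq_abs n).symm
  rw [e, zpow_natCast, ← pow_mul]

theorem chi_zero_eq (k : ℕ) (q : ℝ) :
    chi k 0 q = (∑' n : ℤ, q ^ (k * n.natAbs ^ 2)) / eta q := by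
  rw [chi, ← tsum_div_const]
  refine tsum_congr fun n => ?_
  have e : (k : ℝ) * ((n : ℝ) + ((0 : ℤ) : ℝ) / (2 * k)) ^ 2 = ((k * n.natAbs ^ 2 : ℕ) : ℝ) := by
    push_cast
    rw [Nat.cast_natAbs, Int.cast_abs, sq_abs, zero_div, add_zero]
  rw [e, Real.rpow_natCast]

theorem hasSum_theta_nat (h0 : 0 < q) (h1 : q < 1) {k : ℕ} (hk : 0 < k) :
    HasSum (fun n : ℕ => q ^ (k * n ^ 2)) (((∑' n : ℤ, q ^ (k * n.natAbs ^ 2)) + 1) / 2) := by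
  have h := (summable_theta h0 h1 hk).hasSum.nat_add_neg
  simp only [Int.natAbs_neg, Int.natAbs_natCast, Int.natAbs_zero, ne_eq, OfNat.ofNat_ne_zero,
    not_false_eq_true, zero_pow, mul_zero, pow_zero] at h
  have e : (fun n : ℕ => q ^ (k * n ^ 2)) = fun n => (q ^ (k * n ^ 2) + q ^ (k * n ^ 2)) / 2 :=
    funext fun n => by ring
  rw [e]
  exact h.div_const 2

/-- All pairs $(s,d)$ with $s\ge0$ are summed, and then those with $s=0$ and an even number of
oscillators are subtracted. The contribution of $s=0$ to the half theta sum cancels against half of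
the unsigned count. -/
theorem hasSum_oddIndex (h0 : 0 < q) (h1 : q < 1) {k : ℕ} (hk : 0 < k) :
    HasSum (fun x : OddIndex => q ^ ((x.energy k : ℝ) - 1 / 24)) (chiStarMinus k q) := by
  have hZ := hasSum_level_of_sign h0 h1 (z := 1) (by simp)
  have hY := hasSum_level_of_sign h0 h1 (z := -1) (by simp)
  simp only [one_pow, one_mul, neg_mul, sub_neg_eq_add] at hZ hY
  have hT := hasSum_theta_nat h0 h1 hk
  have hG := hasSum_mul_real hT hZ
  -- The average of the unsigned and the signed count selects even degree.
  have hH : HasSum (fun x : ℕ × (ℕ+ →₀ ℕ) =>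
      if x.1 = 0 then (q ^ chiralLevel x.2 + (-1) ^ x.2.degree * q ^ chiralLevel x.2) / 2 else 0)
      (((∏' j : ℕ, (1 - q ^ (j + 1)))⁻¹ + (∏' j : ℕ, (1 + q ^ (j + 1)))⁻¹) / 2) := by
    refine (Function.Injective.hasSum_iff (Prod.mk_right_injective 0) ?_).1
      ((hZ.add hY).div_const 2)
    rintro ⟨n, d⟩ hx
    refine if_neg fun h : n = 0 => hx ⟨d, by rw [h]⟩
  have hsub := (hG.sub hH).mul_left (q ^ (-(1 / 24) : ℝ))
  have hval : q ^ (-(1 / 24) : ℝ) * (((∑' n : ℤ, q ^ (k * n.natAbs ^ 2)) + 1) / 2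
      * (∏' j : ℕ, (1 - q ^ (j + 1)))⁻¹ - ((∏' j : ℕ, (1 - q ^ (j + 1)))⁻¹
        + (∏' j : ℕ, (1 + q ^ (j + 1)))⁻¹) / 2) = chiStarMinus k q := by
    have hE := (qEuler_pos h0 h1).ne'
    have hq := (Real.rpow_pos_of_pos h0 (1 / 24 : ℝ)).ne'
    rw [chiStarMinus, chi_zero_eq, chiC_eq h0 h1, eta_eq, ← qEuler, Real.rpow_neg h0.le]
    field_simp
    ring
  rw [hval] at hsub
  have hcongr : ∀ {f g : ℕ × (ℕ+ →₀ ℕ) → ℝ} {a : ℝ}, HasSum g a → (∀ x, f x = g x) →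
      HasSum f a := fun hg h => by rwa [funext h]
  refine (hasSum_subtype_iff_indicator (s := {x : ℕ × (ℕ+ →₀ ℕ) | x.1 = 0 → Odd x.2.degree})
    (f := fun x => q ^ (((k * x.1 ^ 2 + chiralLevel x.2 : ℕ) : ℝ) - 1 / 24))
    (a := chiStarMinus k q)).2 (hcongr hsub fun x => ?_)
  have hr : q ^ (((k * x.1 ^ 2 + chiralLevel x.2 : ℕ) : ℝ) - 1 / 24)
      = q ^ (-(1 / 24) : ℝ) * (q ^ (k * x.1 ^ 2) * q ^ chiralLevel x.2) := by
    rw [sub_eq_neg_add, Real.rpow_add h0, Real.rpow_natCast, pow_add]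
  by_cases hx : x.1 = 0
  · rcases Nat.even_or_odd x.2.degree with hd | hd
    · rw [Set.indicator_of_notMem (by simp [hx, hd]), if_pos hx, hd.neg_one_pow, hx]
      simp
    · rw [Set.indicator_of_mem (by simp [hd]), if_pos hx, hd.neg_one_pow, hr]
      ring
  · rw [Set.indicator_of_mem (by simp [hx]), if_neg hx, hr, sub_zero]

theorem hasSum_oddIndex_prod (h0 : 0 < q) (h1 : q < 1) {k : ℕ} (hk : 0 < k) :
    HasSum (fun x : OddIndex × OddIndex =>
      q ^ (((x.1.energy k + x.2.energy k : ℕ) : ℝ) - 1 / 12)) (chiStarMinus k q ^ 2) := by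
  have h := hasSum_oddIndex h0 h1 hk
  have e : (fun x : OddIndex × OddIndex =>
      q ^ (((x.1.energy k + x.2.energy k : ℕ) : ℝ) - 1 / 12)) = fun x =>
      q ^ ((x.1.energy k : ℝ) - 1 / 24) * q ^ ((x.2.energy k : ℝ) - 1 / 24) := by
    funext x
    rw [← Real.rpow_add h0]
    congr 1
    push_cast
    ring
  rw [sq, e]
  exact hasSum_mul_real h h

end Character

/-! ### Traces from a basis of eigenvectors -/

section Trace

variable {V ι : Type*} [AddCommGroup V] [Module ℂ V] {L : Module.End ℂ V} {b : ι → V} {E : ι → ℝ}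

/-- Applying $L-\mu$ multiplies the coefficient of $b_i$ by $E_i-\mu$, so linear independence forces
it to vanish unless $E_i=\mu$. -/
theorem span_inf_eigenspace (hb : LinearIndependent ℂ b) (hL : ∀ i, L (b i) = (E i : ℂ) • b i)
    (μ : ℝ) : Submodule.span ℂ (Set.range b) ⊓ L.eigenspace (μ : ℂ)
      = Submodule.span ℂ (Set.range fun i : {i // E i = μ} => b i) := by
  refine le_antisymm ?_ (le_inf (Submodule.span_mono ?_) (Submodule.span_le.2 ?_))
  · rintro v ⟨hv, hv'⟩
    obtain ⟨l, rfl⟩ := (Finsupp.mem_span_range_iff_exists_finsupp).1 hv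
    have hv' := Module.End.mem_eigenspace_iff.1 hv'
    rw [Finsupp.sum, map_sum, Finset.smul_sum, ← sub_eq_zero, ← Finset.sum_sub_distrib] at hv'
    have h0 : ∑ i ∈ l.support, (l i * ((E i : ℂ) - μ)) • b i = 0 := by
      rw [← hv']
      refine Finset.sum_congr rfl fun i _ => ?_
      rw [map_smul, hL]
      module
    refine Submodule.sum_mem _ fun i hi => Submodule.smul_mem _ _ ?_
    have h1 := linearIndependent_iff'.1 hb _ _ h0 i hi
    rcases mul_eq_zero.1 h1 with h2 | h2
    · exact absurd h2 (Finsupp.mem_support_iff.1 hi)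
    · exact Submodule.subset_span ⟨⟨i, by exact_mod_cast sub_eq_zero.1 h2⟩, rfl⟩
  · rintro _ ⟨i, rfl⟩
    exact ⟨i, rfl⟩
  · rintro _ ⟨⟨i, hi⟩, rfl⟩
    rw [SetLike.mem_coe, Module.End.mem_eigenspace_iff, hL, hi]

theorem hasTraceQPow_span (hb : LinearIndependent ℂ b) (hL : ∀ i, L (b i) = (E i : ℂ) • b i)
    {q c t : ℝ} (hq : 0 < q) (h : HasSum (fun i => q ^ (E i - c)) t) :
    HasTraceQPow L (Submodule.span ℂ (Set.range b)) c q t := by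
  -- Finite multiplicity follows from convergence: an infinite fibre would contribute a nonzero
  -- constant infinitely often.
  have hfin : ∀ μ : ℝ, Finite {i // E i = μ} := by
    intro μ
    by_contra hinf
    rw [not_finite_iff_infinite] at hinf
    have h1 : Summable fun i : {i // E i = μ} => q ^ (E i - c) :=
      h.summable.comp_injective Subtype.val_injective
    have h2 : (fun i : {i // E i = μ} => q ^ (E i - c)) = fun _ => q ^ (μ - c) :=
      funext fun i => by rw [i.2]
    rw [h2, summable_const_iff] at h1
    exact (Real.rpow_pos_of_pos hq _).ne' h1
  refine ⟨le_antisymm ?_ (iSup_le fun μ => inf_le_left), fun μ => ?_, ?_⟩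
  · refine Submodule.span_le.2 ?_
    rintro _ ⟨i, rfl⟩
    exact Submodule.mem_iSup_of_mem (E i) ⟨Submodule.subset_span ⟨i, rfl⟩,
      Module.End.mem_eigenspace_iff.2 (hL i)⟩
  · rw [span_inf_eigenspace hb hL]
    have := hfin μ
    exact FiniteDimensional.span_of_finite ℂ (Set.finite_range _)
  -- The basis sum is regrouped into the fibres of the energy, whose sizes are the multiplicities.
  · have hs := ((Equiv.sigmaFiberEquiv E).hasSum_iff (f := fun i => q ^ (E i - c))).2 h
    refine hs.sigma fun μ => ?_
    have := hfin μ
    have := Fintype.ofFinite {i // E i = μ}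
    have hr : Module.finrank ℂ (Submodule.span ℂ (Set.range fun i : {i // E i = μ} => b i))
        = Fintype.card {i // E i = μ} :=
      finrank_span_eq_card (hb.comp (fun i : {i // E i = μ} => i.1) Subtype.val_injective)
    rw [span_inf_eigenspace hb hL, hr]
    have h1 : (Fintype.card {i // E i = μ} : ℝ) * q ^ (μ - c)
        = ∑ i : {i // E i = μ}, q ^ (E i.1 - c) := by
      rw [Finset.sum_congr rfl (g := fun _ => q ^ (μ - c)) fun i _ => by rw [i.2]]
      simp
    rw [h1]
    exact hasSum_fintype _

end Trace

/-! ### The basis of the odd states -/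

theorem mode_neg_mode_pos_monomial (k : ℕ) (c : Chirality) (n : ℕ+) (x : ℤ × ℤ)
    (D : (Chirality × ℕ+) →₀ ℕ) :
    mode k c (-((n : ℕ) : ℤ)) (mode k c ((n : ℕ) : ℤ) (Finsupp.single x (monomial D 1)))
      = ((D (c, n) * (n : ℕ) : ℕ) : ℂ) • Finsupp.single x (monomial D 1) := by
  rw [mode_pos_single, mode_neg_single, mul_smul_comm, X_mul_pderiv_monomial, Finsupp.smul_single,
    ← Nat.cast_smul_eq_nsmul ℂ, smul_smul, mul_comm]
  push_cast
  rfl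

theorem virasoroZero_monomial (k : ℕ) (c : Chirality) (x : ℤ × ℤ) (D : (Chirality × ℕ+) →₀ ℕ)
    (e : ℕ+ →₀ ℕ) (he : ∀ n, D (c, n) = e n) :
    virasoroZero k c (Finsupp.single x (monomial D 1))
      = (((charge k c x ^ 2 / 2 + chiralLevel e : ℝ)) : ℂ) •
        Finsupp.single x (monomial D 1) := by
  change (1 / 2 : ℂ) • mode k c 0 (mode k c 0 _) + ∑ᶠ n : ℕ+, _ = _
  simp only [mode_neg_mode_pos_monomial, he, mode_zero_single, map_smul]
  rw [finsum_eq_sum_of_support_subset (s := e.support), ← Finset.sum_smul, smul_smul, smul_smul,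
    ← add_smul]
  · congr 1
    rw [chiralLevel, Finsupp.sum]
    push_cast
    ring
  · intro n hn
    rw [Finset.mem_coe, Finsupp.mem_support_iff]
    rintro h
    simp [h] at hn

theorem energy_monomial (k : ℕ) (s s' : ℤ) (d : (ℕ+ →₀ ℕ) × (ℕ+ →₀ ℕ)) :
    (virasoroZero k .hol + virasoroZero k .anti)
        (Finsupp.single (loc k s s') (monomial (pairExp d) 1))
      = ((k * s ^ 2 + chiralLevel d.1 + (k * s' ^ 2 + chiralLevel d.2) : ℝ) : ℂ) •
        Finsupp.single (loc k s s') (monomial (pairExp d) 1) := by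
  have h : Real.sqrt (2 * k) ^ 2 = 2 * k := Real.sq_sqrt (by positivity)
  rw [LinearMap.add_apply, virasoroZero_monomial k .hol _ _ d.1 (pairExp_hol d),
    virasoroZero_monomial k .anti _ _ d.2 (pairExp_anti d), ← add_smul, charge_hol_loc,
    charge_anti_loc, mul_pow, mul_pow, h]
  congr 1
  push_cast
  ring

/-- The energy depends on the charges only through their squares, so the four terms of the
projection share one eigenvalue. -/
theorem energy_oddVec {k : ℕ} (hk : 0 < k) (s s' : ℤ) (d : (ℕ+ →₀ ℕ) × (ℕ+ →₀ ℕ)) :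
    (virasoroZero k .hol + virasoroZero k .anti) (oddVec k s s' d)
      = ((k * s ^ 2 + chiralLevel d.1 + (k * s' ^ 2 + chiralLevel d.2) : ℝ) : ℂ) •
        oddVec k s s' d := by
  simp only [oddVec_eq hk, map_add (virasoroZero k .hol + virasoroZero k .anti), map_sub, map_smul,
    energy_monomial, Int.cast_neg, neg_sq]
  module

/-- The basis of the odd states. -/
def oddBasis (k : ℕ) (x : OddIndex × OddIndex) : StateSpace :=
  oddVec k x.1.1.1 x.2.1.1 (x.1.1.2, x.2.1.2)

theorem span_oddBasis {k : ℕ} (hk : 0 < k) :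
    Submodule.span ℂ (Set.range (oddBasis k)) = oddStates k := by
  refine le_antisymm (Submodule.span_le.2 ?_) (oddStates_le hk _ fun s s' d hs hs' => ?_)
  · rintro _ ⟨x, rfl⟩
    -- Oddness of the basis vectors is taken from part (a): they belong to the generated module.
    rw [← H1_eq_oddStates hk, oddBasis]
    obtain ⟨A, B, -, -, h⟩ := exists_oddVec_eq hk x.1.1.1 x.2.1.1 (x.1.1.2, x.2.1.2)
    rw [h, ← generatedModule_eq_H1 hk]
    exact excite_mem hk _ (fun T hT w hw => apply_mem_generatedModule hT hw)
      (mem_generatedModule _ _) _ _ A B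
  · exact Submodule.subset_span ⟨(⟨(s, d.1), hs⟩, ⟨(s', d.2), hs'⟩), rfl⟩

/-- The coefficient of a monomial state. -/
def stateCoeff (k : ℕ) (s s' : ℤ) (d : (ℕ+ →₀ ℕ) × (ℕ+ →₀ ℕ)) : StateSpace →ₗ[ℂ] ℂ :=
  lcoeff ℂ (pairExp d) ∘ₗ Finsupp.lapply (loc k s s')

theorem stateCoeff_single {k : ℕ} (hk : 0 < k) (s s' t t' : ℤ) (d e : (ℕ+ →₀ ℕ) × (ℕ+ →₀ ℕ)) :
    stateCoeff k s s' d (Finsupp.single (loc k t t') (monomial (pairExp e) 1))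
      = if t = s ∧ t' = s' ∧ e = d then 1 else 0 := by
  have hl : loc k t t' = loc k s s' ↔ t = s ∧ t' = s' :=
    ⟨loc_injective hk, by rintro ⟨rfl, rfl⟩; rfl⟩
  rw [stateCoeff, LinearMap.comp_apply, Finsupp.lapply_apply, Finsupp.single_apply, lcoeff_apply]
  simp only [hl]
  by_cases h : t = s ∧ t' = s'
  · rw [if_pos h, coeff_monomial]
    simp [h.1, h.2, pairExp_injective.eq_iff]
  · rw [if_neg h, coeff_zero, if_neg (fun h' => h ⟨h'.1, h'.2.1⟩)]

/-- The coefficient at the label with nonnegative charges detects each vector. It is 1, 2 or 4 on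
the vector itself, since at zero charge the odd degree makes coinciding terms add up, and it is 0 on
the others. -/
theorem linearIndependent_oddBasis {k : ℕ} (hk : 0 < k) : LinearIndependent ℂ (oddBasis k) := by
  refine linearIndependent_iff'.2 fun S g hg i hi => ?_
  have h := congrArg (stateCoeff k i.1.1.1 i.2.1.1 (i.1.1.2, i.2.1.2)) hg
  rw [map_sum, map_zero, Finset.sum_eq_single i] at h
  · rw [map_smul, smul_eq_mul] at h
    refine (mul_eq_zero.1 h).resolve_right ?_
    simp only [oddBasis, oddVec_eq hk, map_add, map_sub, map_smul, stateCoeff_single hk]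
    obtain ⟨⟨⟨s, d⟩, hs⟩, ⟨⟨s', d'⟩, hs'⟩⟩ := i
    simp only at hs hs' ⊢
    by_cases h1 : s = 0 <;> by_cases h2 : s' = 0
    · simp [h1, h2, (hs h1).neg_one_pow, (hs' h2).neg_one_pow]
      norm_num
    · simp [h1, h2, (hs h1).neg_one_pow, neg_eq_self]
    · simp [h1, h2, (hs' h2).neg_one_pow, neg_eq_self]
    · simp [h1, h2, neg_eq_self]
  · intro j _ hj
    rw [map_smul, smul_eq_zero]
    right
    simp only [oddBasis, oddVec_eq hk, map_add, map_sub, map_smul, stateCoeff_single hk]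
    obtain ⟨⟨⟨s, d⟩, hs⟩, ⟨⟨s', d'⟩, hs'⟩⟩ := i
    obtain ⟨⟨⟨t, e⟩, ht⟩, ⟨⟨t', e'⟩, ht'⟩⟩ := j
    have hne : ¬ ((t = s ∧ t' = s') ∧ (e, e') = (d, d')) := by
      rintro ⟨⟨rfl, rfl⟩, h'⟩
      obtain ⟨rfl, rfl⟩ := Prod.mk.inj h'
      exact hj rfl
    simp only
    -- All four labels have charges $\pm t,\pm t'$; as $s,s',t,t'\ge0$, a match would force $t=s$
    -- and $t'=s'$.
    rw [if_neg, if_neg, if_neg, if_neg]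
    · simp
    all_goals
      rintro ⟨h1, h2, h3⟩
      exact hne ⟨⟨by omega, by omega⟩, h3⟩
  · exact fun h => absurd hi h

theorem hasTraceQPow_H1 {k : ℕ} (hk : 0 < k) {q : ℝ} (h0 : 0 < q) (h1 : q < 1) :
    HasTraceQPow (virasoroZero k .hol + virasoroZero k .anti) (H1 k) (1 / 12) q
      (chiStarMinus k q ^ 2) := by
  rw [H1_eq_oddStates hk, ← span_oddBasis hk]
  set E : OddIndex × OddIndex → ℝ := fun x => ((x.1.energy k + x.2.energy k : ℕ) : ℝ) with hE
  have hs : HasSum (fun x => q ^ (E x - 1 / 12)) (chiStarMinus k q ^ 2) :=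
    hasSum_oddIndex_prod h0 h1 hk
  have hL : ∀ x, (virasoroZero k .hol + virasoroZero k .anti) (oddBasis k x)
      = (E x : ℂ) • oddBasis k x := by
    intro x
    rw [oddBasis, energy_oddVec hk]
    congr 1
    simp only [hE, OddIndex.energy]
    push_cast
    ring
  exact hasTraceQPow_span (linearIndependent_oddBasis hk) hL h0 hs

end

end OrbifoldBoson

/-! ### The generated module and its character -/

theorem proposition2 (k : ℕ) (hk : 0 < k) :
    OrbifoldBoson.generatedModule (OrbifoldBoson.generators k)
        (OrbifoldBoson.mode k .hol (-1) (OrbifoldBoson.mode k .anti (-1)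
          (OrbifoldBoson.ket 0 0))) = OrbifoldBoson.H1 k ∧
      ∀ q : ℝ, 0 < q → q < 1 →
        OrbifoldBoson.HasTraceQPow
          (OrbifoldBoson.virasoroZero k .hol + OrbifoldBoson.virasoroZero k .anti)
          (OrbifoldBoson.H1 k) (1 / 12) q (OrbifoldBoson.chiStarMinus k q ^ 2) :=
  ⟨OrbifoldBoson.generatedModule_eq_H1 hk, fun _ h0 h1 => OrbifoldBoson.hasTraceQPow_H1 hk h0 h1⟩
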